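/- Let $k$ be a field of characteristic $0$, let $c_1,\dots,c_9$ be independent indeterminates over $k$, let $K=k(c_1,\dots,c_9)$, let $\Omega$ be an algebraic closure of $K$, and let $$f(x)=x^9+c_1x^8+\cdots+c_8x+c_9\in K[x]$$ be the general polynomial of the ninth degree. There are finitely many elements $\theta_0,\dots,\theta_{r-1}\in\Omega$ with the following properties. Write $K_i=K(\theta_0,\dots,\theta_{i-1})$, so that $K_0=K$. 1. (Auxiliary equations.) For each $i<r$, $\theta_i$ is a root of a monic polynomial $p_i$ of degree at most $5$ which depends on only one parameter: there is an element $t_i\in K_i$ such that all coefficients of $p_i$ lie in $k(t_i)$. At most one of the polynomials $p_i$ has degree $5$. 2. (Reduction.) There are $a_0,\dots,a_8\in K_r$ such that the Tschirnhaus transformation $y=T(x)=a_0+a_1x+\cdots+a_8x^8$ transforms $f(x)=0$ into an equation of the form $$y^9+C_5y^4+C_6y^3+C_7y^2+C_8y+C_9=0,\qquad C_5,\dots,C_9\in K_r,$$ that is, $\prod_{x}(y-T(x))=y^9+C_5y^4+C_6y^3+C_7y^2+C_8y+C_9$, where $x$ runs through the nine roots of $f$ in $\Omega$. Moreover the transformation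 is invertible: there is a polynomial $S$ with coefficients in $K_r$ such that $S(T(x))=x$ for every root $x$ of $f$. -/

import Mathlib

open Polynomial

noncomputable section

/-- The field `k(c₁, …, c₉)` of rational functions in nine independent indeterminates over the
field of constants `k`. -/
abbrev CoeffField (k : Type*) [Field k] : Type _ :=
  FractionRing (MvPolynomial (Fin 9) k)

/-- The indeterminate coefficient `c_{i+1}`, as an element of `k(c₁, …, c₉)`. -/
def generalCoeff (k : Type*) [Field k] (i : Fin 9) : CoeffField k :=
  algebraMap (MvPolynomial (Fin 9) k) (CoeffField k) (MvPolynomial.X i)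

/-- The general polynomial of the ninth degree `x⁹ + c₁ x⁸ + ⋯ + c₈ x + c₉`. -/
def generalNonic (k : Type*) [Field k] : (CoeffField k)[X] :=
  X ^ 9 + ∑ i : Fin 9, C (generalCoeff k i) * X ^ (8 - (i : ℕ))

/-- The Tschirnhaus substitution `y = a₀ + a₁ x + ⋯ + a₈ x⁸`, as a polynomial in `x`. -/
def tschirnhausPoly {Ω : Type*} [Field Ω] (a : Fin 9 → Ω) : Polynomial Ω :=
  ∑ i : Fin 9, C (a i) * X ^ (i : ℕ)

/-- The polynomial `∏ (y - T(x))`, where `x` runs through the roots of `f` in `Ω`, with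
multiplicity: the transform of `f` under the substitution `y = T(x)`. -/
def transformedPoly {K Ω : Type*} [Field K] [Field Ω] [Algebra K Ω] (f : K[X]) (T : Polynomial Ω) : Polynomial Ω :=
  ((f.aroots Ω).map fun x => X - C (T.eval x)).prod

/-- The field `K(θ₀, …, θ_{i-1})` obtained from `K` after the first `i` adjunctions. -/
def stageField (K : Type*) {Ω : Type*} [Field K] [Field Ω] [Algebra K Ω] (θ : ℕ → Ω) (i : ℕ) :
    IntermediateField K Ω :=
  IntermediateField.adjoin K (θ '' Set.Iio i)

/-- `p = 0` is an equation which depends on a single parameter in `E`: for some `t` in `E`, `p` is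
a monic polynomial whose coefficients are all rational functions of `t` with constants in `k`. -/
def IsOneParameterEquation (k : Type*) {K Ω : Type*} [Field k] [Field K] [Field Ω] [Algebra k Ω]
    [Algebra K Ω] (E : IntermediateField K Ω) (p : Polynomial Ω) : Prop :=
  p.Monic ∧ ∃ t ∈ E, ∀ n, p.coeff n ∈ IntermediateField.adjoin k {t}

/-- `θ₀, …, θ_{r-1}` are determined successively by the `r` auxiliary equations `p₀ = 0`, …,
`p_{r-1} = 0`: `θᵢ` is a root of `pᵢ`, and `pᵢ` has degree at most `5` and depends on a single
parameter, which belongs to `K(θ₀, …, θ_{i-1})`. At most one of the equations is a quintic. -/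
structure IsAuxiliarySystem (k K : Type*) {Ω : Type*} [Field k] [Field K] [Field Ω] [Algebra k Ω]
    [Algebra K Ω] (r : ℕ) (p : ℕ → Polynomial Ω) (θ : ℕ → Ω) : Prop where
  oneParameter : ∀ i < r, IsOneParameterEquation k (stageField K θ i) (p i)
  degree_le : ∀ i < r, (p i).natDegree ≤ 5
  isRoot : ∀ i < r, (p i).IsRoot (θ i)
  quintic_unique : ∀ i < r, ∀ j < r, (p i).natDegree = 5 → (p j).natDegree = 5 → i = j

end

/-! Let `l(P)` be the sum of `P(x)` over the nine roots. By Newton's identities the four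
coefficients after the leading one vanish as soon as `l(T^j) = 0` for `j = 1, …, 4`, so a common
zero of forms of degrees 1, 2, 3, 4 on the nine-dimensional space of substitutions is wanted.

Let `L₀` be the closure of `K` under square and cube roots; equations of degree at most four are
solvable in it, and each radical is a root of some `X^n - c`, a one-parameter equation. Over `L₀`
the hyperplane `l(P) = 0` contains a line of the quadric `l(P²) = 0`, and a binary cubic gives a
point `p` on it with `l(p³) = 0`. If also `l(v) = l(pv) = l(p²v) = 0` and `l(v²) = l(pv²) = l(v³) =
0`, then the whole line `pv` satisfies the first three conditions, and a binary quartic finishes.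
The linear conditions leave a five-dimensional space of directions independent of `p`; there remain
two quadrics and a cubic. Two quadrics in five variables have a common line once their pencil has a
singular member (`exists_common_isotropic_plane`), and a binary cubic then gives `v`. The singular
member is a root of a quintic discriminant over `L₀`, the only quintic needed. If it is irreducible,
a Tschirnhaus transformation over `L₀` and a rescaling bring it to `θ⁵ + θ + t` or `θ⁵ + t`, with
one parameter (`exists_radicalClosed_quintic_root`).

Invertibility is group-theoretic. For every `σ` over `K`, the power `σ^(120^r)` fixes `K_r`, since
each step adjoins a root of an equation of degree at most five. The Galois group induces all
permutations of the nine roots, and `120^r` is 1 modulo 7, so 7-cycles are still induced over `K_r`.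
They force `T` to be injective or constant on the roots (`IsAuxiliarySystem.injective_or_constant`).
A constant `T` has value 0 because `l(T) = 0`, and is then the zero polynomial. An injective `T` is
inverted by Lagrange interpolation and Galois descent. -/

/-! ### Equations of degree at most four over radical closed fields -/

/-- A field in which every element has a square root and a cube root. -/
structure RadicalClosed (F : Type*) [Field F] : Prop where
  sqrt : ∀ a : F, ∃ b, b ^ 2 = a
  cbrt : ∀ a : F, ∃ b, b ^ 3 = a

namespace RadicalClosed

variable {F : Type*} [Field F] [CharZero F]

theorem quadratic (h : RadicalClosed F) {a : F} (ha : a ≠ 0) (b c : F) :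
    ∃ x, a * x ^ 2 + b * x + c = 0 := by
  obtain ⟨d, hd⟩ := h.sqrt (b ^ 2 - 4 * a * c)
  refine ⟨(d - b) / (2 * a), ?_⟩
  field_simp
  linear_combination hd

/-- Cardano's formula `x = u - p/(3u)` with `u³ = -q/2 + w`. A single cube root suffices, and `p ≠
0` guarantees `u ≠ 0`. -/
theorem depressed_cubic (h : RadicalClosed F) (p q : F) : ∃ x, x ^ 3 + p * x + q = 0 := by
  by_cases hp : p = 0
  · obtain ⟨x, hx⟩ := h.cbrt (-q)
    exact ⟨x, by rw [hx, hp]; ring⟩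
  obtain ⟨w, hw⟩ := h.sqrt (q ^ 2 / 4 + p ^ 3 / 27)
  obtain ⟨u, hu⟩ := h.cbrt (-q / 2 + w)
  have hu0 : u ≠ 0 := by
    rintro rfl
    have h1 : w = q / 2 := by linear_combination -hu
    rw [h1] at hw
    have : p ^ 3 = 0 := by linear_combination -27 * hw
    exact hp (pow_eq_zero_iff (by norm_num) |>.1 this)
  refine ⟨u - p / (3 * u), ?_⟩
  have key : 27 * u ^ 6 + 27 * q * u ^ 3 - p ^ 3 = 0 := by
    have : u ^ 6 = (-q / 2 + w) ^ 2 := by rw [← hu]; ring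
    rw [this, hu]
    linear_combination 27 * hw
  field_simp
  linear_combination key

theorem cubic (h : RadicalClosed F) {a : F} (ha : a ≠ 0) (b c d : F) :
    ∃ x, a * x ^ 3 + b * x ^ 2 + c * x + d = 0 := by
  obtain ⟨y, hy⟩ := h.depressed_cubic (c / a - b ^ 2 / (3 * a ^ 2))
    (2 * b ^ 3 / (27 * a ^ 3) - b * c / (3 * a ^ 2) + d / a)
  refine ⟨y - b / (3 * a), ?_⟩
  field_simp at hy ⊢
  linear_combination hy / 3

/-- Descartes' factorization into `x² + a x + (p + a² - q/a)/2` and `x² - a x + (p + a² + q/a)/2`,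
where `a²` is a root of the resolvent cubic. The case `q = 0` is biquadratic; otherwise `a ≠ 0`. -/
theorem depressed_quartic (h : RadicalClosed F) (p q r : F) :
    ∃ x, x ^ 4 + p * x ^ 2 + q * x + r = 0 := by
  by_cases hq : q = 0
  · obtain ⟨z, hz⟩ := h.quadratic one_ne_zero p r
    obtain ⟨x, hx⟩ := h.sqrt z
    exact ⟨x, by rw [hq]; linear_combination hz + (x ^ 2 + z + p) * hx⟩
  obtain ⟨z, hz⟩ := h.cubic one_ne_zero (2 * p) (p ^ 2 - 4 * r) (-q ^ 2)
  obtain ⟨a, rfl⟩ := h.sqrt z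
  have ha : a ≠ 0 := by
    rintro rfl
    exact hq (pow_eq_zero_iff two_ne_zero |>.1 (by linear_combination -hz))
  obtain ⟨x, hx⟩ := h.quadratic one_ne_zero a ((p + a ^ 2 - q / a) / 2)
  refine ⟨x, ?_⟩
  field_simp at hx
  have key : 4 * a ^ 2 * (x ^ 4 + p * x ^ 2 + q * x + r) = 0 := by
    linear_combination (2 * a * (x ^ 2 - a * x) + (p * a + a ^ 3 + q)) * hx - hz
  exact (mul_eq_zero.1 key).resolve_left (by simp [ha])

theorem quartic (h : RadicalClosed F) {a : F} (ha : a ≠ 0) (b c d e : F) :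
    ∃ x, a * x ^ 4 + b * x ^ 3 + c * x ^ 2 + d * x + e = 0 := by
  obtain ⟨y, hy⟩ := h.depressed_quartic (c / a - 3 * b ^ 2 / (8 * a ^ 2))
    (b ^ 3 / (8 * a ^ 3) - b * c / (2 * a ^ 2) + d / a)
    (-3 * b ^ 4 / (256 * a ^ 4) + b ^ 2 * c / (16 * a ^ 3) - b * d / (4 * a ^ 2) + e / a)
  refine ⟨y - b / (4 * a), ?_⟩
  field_simp at hy ⊢
  linear_combination hy / 1024

theorem exists_root (h : RadicalClosed F) {p : F[X]} (h1 : 1 ≤ p.natDegree)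
    (h4 : p.natDegree ≤ 4) : ∃ x, p.eval x = 0 := by
  have hl : p.coeff p.natDegree ≠ 0 := by
    rw [coeff_natDegree, leadingCoeff_ne_zero]
    rintro rfl
    simp at h1
  simp only [eval_eq_sum_range]
  generalize p.natDegree = n at *
  interval_cases n <;> simp only [Finset.sum_range_succ, Finset.sum_range_zero]
  · refine ⟨-p.coeff 0 / p.coeff 1, ?_⟩
    field_simp
    ring
  · obtain ⟨x, hx⟩ := h.quadratic hl (p.coeff 1) (p.coeff 0)
    exact ⟨x, by linear_combination hx⟩
  · obtain ⟨x, hx⟩ := h.cubic hl (p.coeff 2) (p.coeff 1) (p.coeff 0)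
    exact ⟨x, by linear_combination hx⟩
  · obtain ⟨x, hx⟩ := h.quartic hl (p.coeff 3) (p.coeff 2) (p.coeff 1) (p.coeff 0)
    exact ⟨x, by linear_combination hx⟩

theorem binary_quadratic (h : RadicalClosed F) (a b c : F) :
    ∃ s t : F, (s ≠ 0 ∨ t ≠ 0) ∧ a * s ^ 2 + b * s * t + c * t ^ 2 = 0 := by
  by_cases ha : a = 0
  · exact ⟨1, 0, by simp [ha]⟩
  obtain ⟨x, hx⟩ := h.quadratic ha b c
  exact ⟨x, 1, by simp, by linear_combination hx⟩

theorem binary_cubic (h : RadicalClosed F) (a b c d : F) :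
    ∃ s t : F, (s ≠ 0 ∨ t ≠ 0) ∧ a * s ^ 3 + b * s ^ 2 * t + c * s * t ^ 2 + d * t ^ 3 = 0 := by
  by_cases ha : a = 0
  · exact ⟨1, 0, by simp [ha]⟩
  obtain ⟨x, hx⟩ := h.cubic ha b c d
  exact ⟨x, 1, by simp, by linear_combination hx⟩

theorem binary_quartic (h : RadicalClosed F) (a b c d e : F) :
    ∃ s t : F, (s ≠ 0 ∨ t ≠ 0) ∧
      a * s ^ 4 + b * s ^ 3 * t + c * s ^ 2 * t ^ 2 + d * s * t ^ 3 + e * t ^ 4 = 0 := by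
  by_cases ha : a = 0
  · exact ⟨1, 0, by simp [ha]⟩
  obtain ⟨x, hx⟩ := h.quartic ha b c d e
  exact ⟨x, 1, by simp, by linear_combination hx⟩

end RadicalClosed

/-! ### Isotropic vectors and planes of one or two quadratic forms -/

section Quadrics

open Module

variable {F V : Type*} [Field F] [AddCommGroup V] [Module F V]

theorem finrank_le_finrank_inf_ker_add_one [FiniteDimensional F V] (W : Submodule F V)
    (φ : V →ₗ[F] F) : finrank F W ≤ finrank F ↥(W ⊓ LinearMap.ker φ) + 1 := by
  have h1 := Submodule.finrank_sup_add_finrank_inf_eq W (LinearMap.ker φ)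
  have h2 := LinearMap.finrank_range_add_finrank_ker φ
  have h3 : finrank F (LinearMap.range φ) ≤ 1 := (Submodule.finrank_le _).trans (by simp)
  have h4 := Submodule.finrank_le (W ⊔ LinearMap.ker φ)
  omega

theorem exists_linearIndependent_cons_of_lt_finrank_submodule [FiniteDimensional F V]
    (W : Submodule F V) {w : V} (hw : w ≠ 0) (k : ℕ) (hk : k + 1 ≤ finrank F W) :
    ∃ b : Fin k → V, (∀ i, b i ∈ W) ∧ LinearIndependent F (Fin.cons w b : Fin (k + 1) → V) := by
  induction k with
  | zero =>
    refine ⟨Fin.elim0, fun i => i.elim0, ?_⟩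
    rw [linearIndependent_finCons]
    exact ⟨linearIndependent_empty_type, by simpa using hw⟩
  | succ k ih =>
    obtain ⟨b, hb, hl⟩ := ih (by omega)
    have : ∃ x ∈ W, x ∉ Submodule.span F (Set.range (Fin.cons w b : Fin (k + 1) → V)) := by
      by_contra! hcon
      have h1 := Submodule.finrank_mono (show W ≤ _ from hcon)
      rw [finrank_span_eq_card hl, Fintype.card_fin] at h1
      omega
    obtain ⟨x, hxW, hx⟩ := this
    refine ⟨Fin.snoc b x, fun i => ?_, ?_⟩
    · refine Fin.lastCases ?_ (fun j => ?_) i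
      · simpa using hxW
      · simpa using hb j
    · rw [Fin.cons_snoc_eq_snoc_cons]
      exact linearIndependent_finSnoc.2 ⟨hl, hx⟩

/-- A parametrization of a `k`-dimensional part of `W` which is independent of the vector `w`. -/
theorem exists_linearMap_disjoint_of_lt_finrank [FiniteDimensional F V]
    (W : Submodule F V) {w : V} (hw : w ≠ 0) (k : ℕ) (hk : k + 1 ≤ finrank F W) :
    ∃ f : (Fin k → F) →ₗ[F] V, (∀ c, f c ∈ W) ∧ ∀ (s : F) c, s • w + f c = 0 → s = 0 ∧ c = 0 := by
  obtain ⟨b, hb, hl⟩ := exists_linearIndependent_cons_of_lt_finrank_submodule W hw k hk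
  refine ⟨Fintype.linearCombination F b, fun c => ?_, fun s c h => ?_⟩
  · rw [Fintype.linearCombination_apply]
    exact W.sum_mem fun i _ => W.smul_mem _ (hb i)
  · rw [Fintype.linearIndependent_iff] at hl
    have := hl (Fin.cons s c) (by
      rw [Fin.sum_univ_succ]
      simpa [Fintype.linearCombination_apply] using h)
    exact ⟨by simpa using this 0, funext fun i => by simpa using this i.succ⟩

variable [FiniteDimensional F V]

theorem exists_isotropic [CharZero F] (hF : RadicalClosed F) (W : Submodule F V)
    (hW : 2 ≤ finrank F W) (B : LinearMap.BilinForm F V) :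
    ∃ v ∈ W, v ≠ 0 ∧ B v v = 0 := by
  have hne : W ≠ ⊥ := by
    rintro rfl
    simp at hW
  obtain ⟨w, hwW, hw⟩ := W.ne_bot_iff.1 hne
  obtain ⟨f, hfW, hf⟩ := exists_linearMap_disjoint_of_lt_finrank W hw 1 hW
  set x := f (fun _ => 1) with hx
  obtain ⟨s, t, hst, h⟩ := hF.binary_quadratic (B w w) (B w x + B x w) (B x x)
  refine ⟨s • w + t • x, W.add_mem (W.smul_mem _ hwW) (W.smul_mem _ (hfW _)), fun h0 => ?_, ?_⟩
  · rw [hx, ← map_smul] at h0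
    obtain ⟨h1, h2⟩ := hf _ _ h0
    have := congrFun h2 0
    simp at this
    tauto
  · simp only [map_add, map_smul, LinearMap.add_apply, LinearMap.smul_apply, smul_eq_mul]
    linear_combination h

/-- Take an isotropic `u`; the kernel of `B u` in `W` still contains a two-dimensional space
independent of `u`, which has an isotropic vector of its own. -/
theorem exists_isotropic_pair [CharZero F] (hF : RadicalClosed F) (W : Submodule F V)
    (hW : 4 ≤ finrank F W) (B : LinearMap.BilinForm F V) :
    ∃ u ∈ W, ∃ v ∈ W, LinearIndependent F ![u, v] ∧ B u u = 0 ∧ B u v = 0 ∧ B v v = 0 := by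
  obtain ⟨u, huW, hu, huu⟩ := exists_isotropic hF W (by omega) B
  obtain ⟨f, hfW, hf⟩ := exists_linearMap_disjoint_of_lt_finrank (W ⊓ LinearMap.ker (B u)) hu 2
    (by have := finrank_le_finrank_inf_ker_add_one W (B u); omega)
  obtain ⟨c, -, hc, hcc⟩ := exists_isotropic hF (⊤ : Submodule F (Fin 2 → F)) (by simp)
    (B.compl₁₂ f f)
  refine ⟨u, huW, f c, (hfW c).1, ?_, huu, by simpa using (hfW c).2, by simpa using hcc⟩
  rw [LinearIndependent.pair_iff]
  intro s t h
  rw [← map_smul] at h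
  obtain ⟨h1, h2⟩ := hf _ _ h
  exact ⟨h1, (smul_eq_zero.1 h2).resolve_right hc⟩

/-- The quadric `A` is a cone with vertex `w`, so the line joining `w` to any of its points `h` lies
on it. Choosing `h` orthogonal to `w` for `B` makes the intersection of that line with `B` a pure
square root. -/
theorem exists_common_isotropic_of_singular [CharZero F] (hF : RadicalClosed F)
    (hV : 3 ≤ finrank F V) (A B : LinearMap.BilinForm F V)
    (hA : ∀ x y, A x y = A y x) (hB : ∀ x y, B x y = B y x) {w : V} (hw : w ≠ 0)
    (hAw : ∀ x, A w x = 0) : ∃ v ≠ 0, A v v = 0 ∧ B v v = 0 := by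
  by_cases hww : B w w = 0
  · exact ⟨w, hw, hAw w, hww⟩
  obtain ⟨h, hh, hh0, hhA⟩ := exists_isotropic hF (⊤ ⊓ LinearMap.ker (B w)) (by
    have := finrank_le_finrank_inf_ker_add_one ⊤ (B w)
    rw [finrank_top] at this
    omega) A
  have hwh : B w h = 0 := by simpa using hh
  obtain ⟨c, hc⟩ := hF.sqrt (-B h h / B w w)
  refine ⟨c • w + h, fun h0 => ?_, ?_, ?_⟩
  · have h1 := congrArg (B w) h0
    simp [hwh, hww] at h1
    simp [h1, hh0] at h0
  · simp [hAw, hhA, hA h w]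
  · simp [hwh, hB h w]
    field_simp at hc
    linear_combination hc

/-- The vertex `w` of the cone `A` lies on `B`. Lines through `w` on both quadrics correspond to
common points of two conics in a three-dimensional complement of `w` inside the tangent hyperplane
of `B` at `w`. -/
theorem exists_common_isotropic_pair_of_singular_isotropic (hV : 5 ≤ finrank F V)
    (hconics : ∀ A B : LinearMap.BilinForm F (Fin 3 → F), (∀ x y, A x y = A y x) →
      (∀ x y, B x y = B y x) → ∃ v ≠ 0, A v v = 0 ∧ B v v = 0)
    (A B : LinearMap.BilinForm F V)
    (hA : ∀ x y, A x y = A y x) (hB : ∀ x y, B x y = B y x) {w : V} (hw : w ≠ 0)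
    (hAw : ∀ x, A w x = 0) (hBw : B w w = 0) :
    ∃ u v, LinearIndependent F ![u, v] ∧ (A u u = 0 ∧ A u v = 0 ∧ A v v = 0) ∧
      B u u = 0 ∧ B u v = 0 ∧ B v v = 0 := by
  obtain ⟨f, hfW, hf⟩ := exists_linearMap_disjoint_of_lt_finrank (⊤ ⊓ LinearMap.ker (B w)) hw 3
    (by have := finrank_le_finrank_inf_ker_add_one ⊤ (B w); rw [finrank_top] at this; omega)
  obtain ⟨c, hc, hcA, hcB⟩ := hconics (A.compl₁₂ f f) (B.compl₁₂ f f)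
    (fun x y => hA _ _) (fun x y => hB _ _)
  refine ⟨w, f c, ?_, ⟨hAw w, hAw _, by simpa using hcA⟩, hBw, by simpa using hfW c,
    by simpa using hcB⟩
  rw [LinearIndependent.pair_iff]
  intro s t h
  rw [← map_smul] at h
  obtain ⟨h1, h2⟩ := hf _ _ h
  exact ⟨h1, (smul_eq_zero.1 h2).resolve_right hc⟩

/-- A nondegenerate symmetric form on a space of dimension at least four contains two orthogonal
hyperbolic planes. -/
theorem exists_two_hyperbolic_planes [CharZero F] (hF : RadicalClosed F)
    (W : Submodule F V) (hW : 4 ≤ finrank F W) (A : LinearMap.BilinForm F V) (hA : ∀ x y, A x y = A y x)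
    (hnd : ∀ x ∈ W, (∀ y ∈ W, A x y = 0) → x = 0) :
    ∃ e₁ ∈ W, ∃ e₂ ∈ W, ∃ e₃ ∈ W, ∃ e₄ ∈ W, A e₁ e₁ = 0 ∧ A e₂ e₂ = 0 ∧ A e₃ e₃ = 0 ∧
      A e₄ e₄ = 0 ∧ A e₁ e₂ = 1 ∧ A e₃ e₄ = -1 ∧ A e₁ e₃ = 0 ∧ A e₁ e₄ = 0 ∧ A e₂ e₃ = 0 ∧
      A e₂ e₄ = 0 := by
  obtain ⟨e₁, h1W, h10, h11⟩ := exists_isotropic hF W (by omega) A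
  obtain ⟨x, hxW, hx⟩ : ∃ x ∈ W, A e₁ x ≠ 0 := by
    by_contra! hcon
    exact h10 (hnd _ h1W hcon)
  obtain ⟨e₂, h2W, h12, h22⟩ : ∃ e₂ ∈ W, A e₁ e₂ = 1 ∧ A e₂ e₂ = 0 := by
    -- Adding a multiple of the isotropic `e₁` does not change the pairing with `e₁`, and the
    -- multiple is chosen to cancel the square of the rescaled `x`.
    refine ⟨(A e₁ x)⁻¹ • x - (A x x / (2 * (A e₁ x) ^ 2)) • e₁,
      W.sub_mem (W.smul_mem _ hxW) (W.smul_mem _ h1W), ?_, ?_⟩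
    · simp [h11, hx]
    · simp [h11, hA x e₁]
      field_simp
      ring
  have hW1 := finrank_le_finrank_inf_ker_add_one W (A e₁)
  have hW2 := finrank_le_finrank_inf_ker_add_one (W ⊓ LinearMap.ker (A e₁)) (A e₂)
  obtain ⟨e₃, ⟨⟨h3W, h13⟩, h23⟩, h30, h33⟩ := exists_isotropic hF
    (W ⊓ LinearMap.ker (A e₁) ⊓ LinearMap.ker (A e₂)) (by omega) A
  obtain ⟨z, hzW, hz⟩ : ∃ x ∈ W, A e₃ x ≠ 0 := by
    by_contra! hcon
    exact h30 (hnd _ h3W hcon)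
  replace h13 : A e₁ e₃ = 0 := h13
  replace h23 : A e₂ e₃ = 0 := h23
  obtain ⟨y, hyW, hy, h1y, h2y⟩ : ∃ y ∈ W, A e₃ y ≠ 0 ∧ A e₁ y = 0 ∧ A e₂ y = 0 := by
    refine ⟨z - A e₂ z • e₁ - A e₁ z • e₂, W.sub_mem (W.sub_mem hzW (W.smul_mem _ h1W))
      (W.smul_mem _ h2W), ?_, ?_, ?_⟩
    · simpa [hA e₃ e₁, hA e₃ e₂, h13, h23] using hz
    · simp [h11, h12]
    · simp [h22, hA e₂ e₁, h12]
  refine ⟨e₁, h1W, e₂, h2W, e₃, h3W, -(A e₃ y)⁻¹ • y + (A y y / (2 * (A e₃ y) ^ 2)) • e₃,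
      W.add_mem (W.smul_mem _ hyW) (W.smul_mem _ h3W), h11, h22, h33, ?_, h12, ?_, h13, ?_, h23, ?_⟩
  · simp [h33, hA y e₃]
    field_simp
    ring
  · simp [h33, hy]
  · simp [h1y, h13]
  · simp [h2y, h23]

/-- When the vertex `w` of `A` is not on `B`, pass to the hyperplane `B w = 0`. There `A` is a
quadric surface with a ruling, and a ruling line tangent to `B` lifts along `w` to a line on both
quadrics. Tangency is a quartic condition on the parameter of the ruling. -/
theorem exists_common_isotropic_pair_of_singular [CharZero F] (hF : RadicalClosed F)
    (hV : 5 ≤ finrank F V)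
    (hconics : ∀ A B : LinearMap.BilinForm F (Fin 3 → F), (∀ x y, A x y = A y x) →
      (∀ x y, B x y = B y x) → ∃ v ≠ 0, A v v = 0 ∧ B v v = 0)
    (A B : LinearMap.BilinForm F V)
    (hA : ∀ x y, A x y = A y x) (hB : ∀ x y, B x y = B y x) {w : V} (hw : w ≠ 0)
    (hAw : ∀ x, A w x = 0) :
    ∃ u v, LinearIndependent F ![u, v] ∧ (A u u = 0 ∧ A u v = 0 ∧ A v v = 0) ∧
      B u u = 0 ∧ B u v = 0 ∧ B v v = 0 := by
  have hsing := fun (w : V) => exists_common_isotropic_pair_of_singular_isotropic hV hconics A B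
    hA hB (w := w)
  by_cases hww : B w w = 0
  · exact hsing w hw hAw hww
  have hW := finrank_le_finrank_inf_ker_add_one ⊤ (B w)
  rw [finrank_top, top_inf_eq] at hW
  by_cases hnd : ∀ x ∈ LinearMap.ker (B w), (∀ y ∈ LinearMap.ker (B w), A x y = 0) → x = 0
  · obtain ⟨e₁, h1, e₂, h2, e₃, h3, e₄, h4, h11, h22, h33, h44, h12, h34, h13, h14, h23, h24⟩ :=
      exists_two_hyperbolic_planes hF (LinearMap.ker (B w)) (by omega) A hA hnd
    rw [LinearMap.mem_ker] at h1 h2 h3 h4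
    -- The ruling of `A` consists of the lines spanned by `s e₁ + t e₃` and `t e₂ + s e₄`; the sign
    -- in `A e₃ e₄ = -1` makes the two vectors orthogonal. The quartic is the Gram determinant of
    -- `B` on this line.
    obtain ⟨s, t, hst, hq⟩ := hF.binary_quartic
      (B e₁ e₁ * B e₄ e₄ - B e₁ e₄ ^ 2)
      (2 * B e₁ e₁ * B e₂ e₄ + 2 * B e₁ e₃ * B e₄ e₄ - 2 * B e₁ e₄ * (B e₁ e₂ + B e₃ e₄))
      (B e₁ e₁ * B e₂ e₂ + 4 * B e₁ e₃ * B e₂ e₄ + B e₃ e₃ * B e₄ e₄ - (B e₁ e₂ + B e₃ e₄) ^ 2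
        - 2 * B e₁ e₄ * B e₂ e₃)
      (2 * B e₁ e₃ * B e₂ e₂ + 2 * B e₃ e₃ * B e₂ e₄ - 2 * B e₂ e₃ * (B e₁ e₂ + B e₃ e₄))
      (B e₃ e₃ * B e₂ e₂ - B e₂ e₃ ^ 2)
    obtain ⟨u, hu⟩ : ∃ u, u = s • e₁ + t • e₃ := ⟨_, rfl⟩
    obtain ⟨v, hv⟩ : ∃ v, v = t • e₂ + s • e₄ := ⟨_, rfl⟩
    have hwu : B w u = 0 := by simp [hu, h1, h3]
    have hwv : B w v = 0 := by simp [hv, h2, h4]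
    have hAuu : A u u = 0 := by simp [hu, h11, h33, h13, hA e₃ e₁]
    have hAvv : A v v = 0 := by simp [hv, h22, h44, h24, hA e₄ e₂]
    have hAuv : A u v = 0 := by
      simp [hu, hv, h12, h34, h14, hA e₃ e₂, h23]
      ring
    have hdet : B u u * B v v = B u v ^ 2 := by
      simp only [hu, hv, map_add, map_smul, LinearMap.add_apply, LinearMap.smul_apply,
        smul_eq_mul, hB e₃ e₁, hB e₄ e₂, hB e₃ e₂]
      linear_combination hq
    have hind : ∀ x y : F, x • u + y • v = 0 → x = 0 ∧ y = 0 := by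
      intro x y h
      have k1 := congrArg (A e₁) h
      have k2 := congrArg (A e₂) h
      have k3 := congrArg (A e₃) h
      have k4 := congrArg (A e₄) h
      simp [hu, hv, h11, h12, h13, h14] at k1
      simp [hu, hv, h22, h23, h24, hA e₂ e₁, h12] at k2
      simp [hu, hv, h33, h34, hA e₃ e₁, h13, hA e₃ e₂, h23] at k3
      simp [hu, hv, h44, hA e₄ e₁, h14, hA e₄ e₂, h24, hA e₄ e₃, h34] at k4
      tauto
    -- With zero Gram determinant, `B` on the line is `-B w w` times the square of a linear form.
    -- Its values `a`, `b` at `u`, `v` are the multiples of `w` to add; the sign of `b` is fixed by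
    -- the mixed term.
    obtain ⟨a, ha⟩ := hF.sqrt (-B u u / B w w)
    obtain ⟨b, hb, hab⟩ : ∃ b, b ^ 2 = -B v v / B w w ∧ a * b = -B u v / B w w := by
      obtain ⟨b, hb⟩ := hF.sqrt (-B v v / B w w)
      have : (a * b) ^ 2 = (-B u v / B w w) ^ 2 := by
        rw [mul_pow, ha, hb]
        field_simp
        linear_combination hdet
      rcases sq_eq_sq_iff_eq_or_eq_neg.1 this with h | h
      · exact ⟨b, hb, h⟩
      · exact ⟨-b, by rw [neg_sq, hb], by rw [mul_neg, h, neg_neg]⟩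
    field_simp at ha hb hab
    refine ⟨a • w + u, b • w + v, ?_, ⟨?_, ?_, ?_⟩, ?_, ?_, ?_⟩
    · rw [LinearIndependent.pair_iff]
      intro x y h
      have h5 := congrArg (B w) h
      simp [hwu, hwv] at h5
      have h6 : x * a + y * b = 0 := by
        have : (x * a + y * b) * B w w = 0 := by linear_combination h5
        exact (mul_eq_zero.1 this).resolve_right hww
      refine hind x y ?_
      have : x • (a • w + u) + y • (b • w + v) = (x * a + y * b) • w + (x • u + y • v) := by
        module
      rwa [this, h6, zero_smul, zero_add] at h
    · simp [hAw, hA u w, hAuu]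
    · simp [hAw, hA u w, hAuv]
    · simp [hAw, hA v w, hAvv]
    · simp [hwu, hB u w]
      linear_combination ha
    · simp [hwv, hB u w, hwu]
      linear_combination hab
    · simp [hwv, hB v w]
      linear_combination hb
  -- A vector `w'` of the radical of `A` on the hyperplane is in the radical of `A` on the whole
  -- space. The vertices of `A` then include the line `w w'`, which meets `B`, and the isotropic
  -- case applies.
  · push Not at hnd
    obtain ⟨w', hw', hAw', hw0⟩ := hnd
    have hwB : B w w' = 0 := hw'
    have hAw'' : ∀ x, A w' x = 0 := by
      intro x
      have h1 := hAw' (x - (B w x / B w w) • w) (by simp [hww])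
      simpa [hA w' w, hAw] using h1
    obtain ⟨c, hc⟩ := hF.sqrt (-B w' w' / B w w)
    refine hsing (c • w + w') (fun h0 => ?_) (by simp [hAw, hAw'']) ?_
    · have h1 := congrArg (B w) h0
      simp [hwB, hww] at h1
      simp [h1, hw0] at h0
    · simp [hwB, hB w' w]
      field_simp at hc
      linear_combination hc

end Quadrics

/-! ### Singular members of pencils of quadrics -/

section Pencils

variable {F : Type*} [Field F]

theorem exists_singular_member {n : ℕ} (A B : LinearMap.BilinForm F (Fin n → F))
    (hA : ∀ x y, A x y = A y x) (hB : ∀ x y, B x y = B y x) (μ l : F)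
    (hdet : (μ • LinearMap.toMatrix₂' F A + l • LinearMap.toMatrix₂' F B).det = 0) :
    ∃ w ≠ 0, ∀ x, (μ • A + l • B) w x = 0 := by
  obtain ⟨w, hw, h⟩ := Matrix.exists_mulVec_eq_zero_iff.2 hdet
  refine ⟨w, hw, fun x => ?_⟩
  have h1 : (μ • A + l • B) w x = (μ • A + l • B) x w := by simp [hA w x, hB w x]
  have h2 : μ • LinearMap.toMatrix₂' F A + l • LinearMap.toMatrix₂' F B =
      LinearMap.toMatrix₂' F (μ • A + l • B) := by simp
  rw [h1, ← Matrix.toLinearMap₂'_toMatrix' (R := F) (μ • A + l • B),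
    Matrix.toLinearMap₂'_apply', ← h2, h, dotProduct_zero]

/-- If the polynomial `det (X A + B)` has a root as soon as it has the full degree, then the pencil
generated by `A` and `B` has a singular member. -/
theorem exists_det_pencil_eq_zero {n : ℕ} (A B : Matrix (Fin n) (Fin n) F)
    (h : ((X : F[X]) • A.map C + B.map C).det.natDegree = n →
      ∃ x, ((X : F[X]) • A.map C + B.map C).det.eval x = 0) :
    ∃ μ l : F, (μ ≠ 0 ∨ l ≠ 0) ∧ (μ • A + l • B).det = 0 := by
  -- The coefficient of `X ^ n` is `det A`. If it vanishes, the singular member is `A` itself, the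
  -- root at infinity; otherwise the degree is exactly `n`.
  by_cases hA : A.det = 0
  · exact ⟨1, 0, by simp, by simpa using hA⟩
  obtain ⟨x, hx⟩ := h (by
    refine le_antisymm (by simpa using natDegree_det_X_add_C_le A B) (le_natDegree_of_ne_zero ?_)
    have := coeff_det_X_add_C_card A B
    rw [Fintype.card_fin] at this
    rwa [this])
  refine ⟨x, 1, by simp, ?_⟩
  rw [← coe_evalRingHom, RingHom.map_det] at hx
  rw [← hx]
  congr 1
  ext i j
  simp [mul_comm x]

variable [CharZero F]

/-- Two plane conics have a common point over a radical closed field. -/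
theorem exists_common_isotropic_vector (hF : RadicalClosed F)
    (A B : LinearMap.BilinForm F (Fin 3 → F))
    (hA : ∀ x y, A x y = A y x) (hB : ∀ x y, B x y = B y x) :
    ∃ v ≠ 0, A v v = 0 ∧ B v v = 0 := by
  obtain ⟨μ, l, hml, hdet⟩ := exists_det_pencil_eq_zero (LinearMap.toMatrix₂' F A)
    (LinearMap.toMatrix₂' F B) fun h => hF.exists_root (by omega) (by omega)
  obtain ⟨w, hw, hAw⟩ := exists_singular_member A B hA hB μ l hdet
  -- The singular member replaces one generator of the pencil; the other generator must be one that
  -- still spans the pencil with it.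
  by_cases hμ : μ = 0
  · have hl : l ≠ 0 := by tauto
    obtain ⟨v, hv, h1, h2⟩ := exists_common_isotropic_of_singular hF (by simp) (μ • A + l • B) A
      (fun x y => by simp [hA x y, hB x y]) hA hw hAw
    exact ⟨v, hv, h2, by simpa [hμ, hl] using h1⟩
  · obtain ⟨v, hv, h1, h2⟩ := exists_common_isotropic_of_singular hF (by simp) (μ • A + l • B) B
      (fun x y => by simp [hA x y, hB x y]) hB hw hAw
    exact ⟨v, hv, by simpa [h2, hμ] using h1, h2⟩

/-- Two quadratic forms in five variables have a common isotropic plane if their pencil has a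
singular member. -/
theorem exists_common_isotropic_plane (hF : RadicalClosed F)
    (A B : LinearMap.BilinForm F (Fin 5 → F))
    (hA : ∀ x y, A x y = A y x) (hB : ∀ x y, B x y = B y x) (μ l : F) (hml : μ ≠ 0 ∨ l ≠ 0)
    (hdet : (μ • LinearMap.toMatrix₂' F A + l • LinearMap.toMatrix₂' F B).det = 0) :
    ∃ u v, LinearIndependent F ![u, v] ∧ (A u u = 0 ∧ A u v = 0 ∧ A v v = 0) ∧
      B u u = 0 ∧ B u v = 0 ∧ B v v = 0 := by
  obtain ⟨w, hw, hAw⟩ := exists_singular_member A B hA hB μ l hdet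
  by_cases hμ : μ = 0
  · have hl : l ≠ 0 := by tauto
    obtain ⟨u, v, huv, ⟨h1, h2, h3⟩, h4, h5, h6⟩ := exists_common_isotropic_pair_of_singular hF
      (by simp) (exists_common_isotropic_vector hF) (μ • A + l • B) A
      (fun x y => by simp [hA x y, hB x y]) hA hw hAw
    refine ⟨u, v, huv, ⟨h4, h5, h6⟩, ?_, ?_, ?_⟩
    · simpa [hμ, hl] using h1
    · simpa [hμ, hl] using h2
    · simpa [hμ, hl] using h3
  · obtain ⟨u, v, huv, ⟨h1, h2, h3⟩, h4, h5, h6⟩ := exists_common_isotropic_pair_of_singular hF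
      (by simp) (exists_common_isotropic_vector hF) (μ • A + l • B) B
      (fun x y => by simp [hA x y, hB x y]) hB hw hAw
    refine ⟨u, v, huv, ⟨?_, ?_, ?_⟩, h4, h5, h6⟩
    · simpa [h4, hμ] using h1
    · simpa [h5, hμ] using h2
    · simpa [h6, hμ] using h3

end Pencils

/-! ### Power-sum forms on an algebra with a linear functional -/

section TraceForms

open Module

variable {F A V : Type*} [Field F] [CommRing A] [Algebra F A] [AddCommGroup V] [Module F V]

/-- The symmetric bilinear form `(x, y) ↦ l (p x y)`. -/
def weightedForm (l : A →ₗ[F] F) (p : A) : LinearMap.BilinForm F A :=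
  (LinearMap.mul F A).compr₂ (l ∘ₗ LinearMap.mulLeft F p)

@[simp]
theorem weightedForm_apply (l : A →ₗ[F] F) (p x y : A) : weightedForm l p x y = l (p * (x * y)) :=
  rfl

variable [CharZero F]

theorem exists_map_cube_eq_zero (hF : RadicalClosed F) (l : A →ₗ[F] F) (u v : A) :
    ∃ s t : F, (s ≠ 0 ∨ t ≠ 0) ∧ l ((s • u + t • v) ^ 3) = 0 := by
  obtain ⟨s, t, hst, h⟩ := hF.binary_cubic (l (u ^ 3)) (3 * l (u ^ 2 * v)) (3 * l (u * v ^ 2))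
    (l (v ^ 3))
  refine ⟨s, t, hst, ?_⟩
  have : (s • u + t • v) ^ 3 = s ^ 3 • u ^ 3 + (3 * s ^ 2 * t) • (u ^ 2 * v) +
      (3 * s * t ^ 2) • (u * v ^ 2) + t ^ 3 • v ^ 3 := by
    simp only [Algebra.smul_def, map_mul, map_pow, map_ofNat]
    ring
  rw [this]
  simp only [map_add, map_smul, smul_eq_mul]
  linear_combination h

theorem exists_map_fourth_pow_eq_zero (hF : RadicalClosed F) (l : A →ₗ[F] F) (u v : A) :
    ∃ s t : F, (s ≠ 0 ∨ t ≠ 0) ∧ l ((s • u + t • v) ^ 4) = 0 := by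
  obtain ⟨s, t, hst, h⟩ := hF.binary_quartic (l (u ^ 4)) (4 * l (u ^ 3 * v))
    (6 * l (u ^ 2 * v ^ 2)) (4 * l (u * v ^ 3)) (l (v ^ 4))
  refine ⟨s, t, hst, ?_⟩
  have : (s • u + t • v) ^ 4 = s ^ 4 • u ^ 4 + (4 * s ^ 3 * t) • (u ^ 3 * v) +
      (6 * s ^ 2 * t ^ 2) • (u ^ 2 * v ^ 2) + (4 * s * t ^ 3) • (u * v ^ 3) + t ^ 4 • v ^ 4 := by
    simp only [Algebra.smul_def, map_mul, map_pow, map_ofNat]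
    ring
  rw [this]
  simp only [map_add, map_smul, smul_eq_mul]
  linear_combination h

variable [FiniteDimensional F V]

/-- The hyperplane `l = 0` has dimension at least four, so it contains an isotropic plane of
`l(x²)`, on which the cubic condition becomes a binary cubic. This gives both the base point for the
nonic and the Bring–Jerrard substitution for the quintic. -/
theorem exists_map_pow_le_three_eq_zero (hF : RadicalClosed F) (l : A →ₗ[F] F) (f : V →ₗ[F] A)
    (hV : 5 ≤ finrank F V) : ∃ v ≠ 0, l (f v) = 0 ∧ l (f v ^ 2) = 0 ∧ l (f v ^ 3) = 0 := by
  have h1 := finrank_le_finrank_inf_ker_add_one ⊤ (l ∘ₗ f)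
  rw [finrank_top] at h1
  obtain ⟨u, hu, v, hv, huv, h11, h12, h22⟩ := exists_isotropic_pair hF
    (⊤ ⊓ LinearMap.ker (l ∘ₗ f)) (by omega) ((weightedForm l 1).compl₁₂ f f)
  replace hu : l (f u) = 0 := by simpa using hu
  replace hv : l (f v) = 0 := by simpa using hv
  obtain ⟨s, t, hst, h⟩ := exists_map_cube_eq_zero hF l (f u) (f v)
  refine ⟨s • u + t • v, fun h0 => ?_, ?_, ?_, ?_⟩
  · have := LinearIndependent.pair_iff.1 huv s t h0
    tauto
  · simp [hu, hv]
  · simp only [LinearMap.compl₁₂_apply, weightedForm_apply, one_mul] at h11 h12 h22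
    have : f (s • u + t • v) ^ 2 = s ^ 2 • (f u * f u) + (2 * s * t) • (f u * f v) +
        t ^ 2 • (f v * f v) := by
      simp only [map_add, map_smul, Algebra.smul_def, map_mul, map_pow, map_ofNat]
      ring
    rw [this]
    simp [h11, h12, h22]
  · rw [map_add, map_smul, map_smul, h]

/-- A point of the intersection of a quadric and a cubic, together with a five-dimensional space of
directions in which the tangent conditions hold. -/
theorem exists_point_and_tangent_directions (hF : RadicalClosed F) (l : A →ₗ[F] F) (f : V →ₗ[F] A)
    (hV : 9 ≤ finrank F V) :
    ∃ (p : V) (g : (Fin 5 → F) →ₗ[F] V),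
      (l (f p) = 0 ∧ l (f p ^ 2) = 0 ∧ l (f p ^ 3) = 0) ∧
      (∀ c, l (f (g c)) = 0 ∧ l (f p * f (g c)) = 0 ∧ l (f p ^ 2 * f (g c)) = 0) ∧
      ∀ (s : F) c, s • p + g c = 0 → s = 0 ∧ c = 0 := by
  obtain ⟨p, hp, hpp⟩ := exists_map_pow_le_three_eq_zero hF l f (by omega)
  set φ₁ := l ∘ₗ f
  set φ₂ := l ∘ₗ LinearMap.mulLeft F (f p) ∘ₗ f
  set φ₃ := l ∘ₗ LinearMap.mulLeft F (f p ^ 2) ∘ₗ f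
  have h1 := finrank_le_finrank_inf_ker_add_one ⊤ φ₁
  have h2 := finrank_le_finrank_inf_ker_add_one (⊤ ⊓ LinearMap.ker φ₁) φ₂
  have h3 := finrank_le_finrank_inf_ker_add_one (⊤ ⊓ LinearMap.ker φ₁ ⊓ LinearMap.ker φ₂) φ₃
  rw [finrank_top] at h1
  -- Three linear conditions on nine dimensions leave six, one of which is spent on independence
  -- from `p`.
  obtain ⟨g, hg, hgp⟩ := exists_linearMap_disjoint_of_lt_finrank
    (⊤ ⊓ LinearMap.ker φ₁ ⊓ LinearMap.ker φ₂ ⊓ LinearMap.ker φ₃) hp 5 (by omega)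
  exact ⟨p, g, hpp, fun c => ⟨(hg c).1.1.2, (hg c).1.2, (hg c).2⟩, hgp⟩

end TraceForms

/-! ### Towers of one-parameter equations and radical closures -/

section Stages

variable (k : Type*) {K Ω : Type*} [Field k] [Field K] [Field Ω] [Algebra k Ω] [Algebra K Ω]

theorem stageField_mono (θ : ℕ → Ω) : Monotone (stageField K θ) := fun _ _ h =>
  IntermediateField.adjoin.mono _ _ _ (Set.image_mono (Set.Iio_subset_Iio h))

theorem mem_stageField (θ : ℕ → Ω) {i j : ℕ} (h : i < j) : θ i ∈ stageField K θ j :=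
  IntermediateField.subset_adjoin _ _ ⟨i, h, rfl⟩

theorem stageField_update (θ : ℕ → Ω) (x : Ω) {i r : ℕ} (h : i ≤ r) :
    stageField K (Function.update θ r x) i = stageField K θ i := by
  unfold stageField
  congr 1
  refine Set.image_congr fun j hj => Function.update_of_ne ?_ _ _
  exact (lt_of_lt_of_le hj h).ne

variable {k}

theorem IsAuxiliarySystem.update {r : ℕ} {p : ℕ → Polynomial Ω} {θ : ℕ → Ω}
    (h : IsAuxiliarySystem k K r p θ) {P : Polynomial Ω} {x : Ω}
    (hP : IsOneParameterEquation k (stageField K θ r) P) (h5 : P.natDegree ≤ 5)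
    (hx : P.IsRoot x) (hq : P.natDegree = 5 → ∀ i < r, (p i).natDegree ≠ 5) :
    IsAuxiliarySystem k K (r + 1) (Function.update p r P) (Function.update θ r x) where
  oneParameter i hi := by
    rw [stageField_update _ _ (by omega)]
    rcases Nat.lt_succ_iff_lt_or_eq.1 hi with hi | rfl
    · rw [Function.update_of_ne hi.ne]
      exact h.oneParameter i hi
    · simpa using hP
  degree_le i hi := by
    rcases Nat.lt_succ_iff_lt_or_eq.1 hi with hi | rfl
    · rw [Function.update_of_ne hi.ne]
      exact h.degree_le i hi
    · simpa using h5
  isRoot i hi := by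
    rcases Nat.lt_succ_iff_lt_or_eq.1 hi with hi | rfl
    · rw [Function.update_of_ne hi.ne, Function.update_of_ne hi.ne]
      exact h.isRoot i hi
    · simpa using hx
  quintic_unique i hi j hj hi5 hj5 := by
    rcases Nat.lt_succ_iff_lt_or_eq.1 hi with hi | rfl <;>
    rcases Nat.lt_succ_iff_lt_or_eq.1 hj with hj | rfl
    · rw [Function.update_of_ne hi.ne] at hi5
      rw [Function.update_of_ne hj.ne] at hj5
      exact h.quintic_unique i hi j hj hi5 hj5
    · rw [Function.update_of_ne hi.ne] at hi5
      rw [Function.update_self] at hj5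
      exact absurd hi5 (hq hj5 i hi)
    · rw [Function.update_of_ne hj.ne] at hj5
      rw [Function.update_self] at hi5
      exact absurd hj5 (hq hi5 j hj)
    · rfl

variable (k)

/-- `E` is the last field of a system of auxiliary equations of degree at most `m`. -/
def IsStage (m : ℕ) (E : IntermediateField K Ω) : Prop :=
  ∃ (r : ℕ) (p : ℕ → Polynomial Ω) (θ : ℕ → Ω), IsAuxiliarySystem k K r p θ ∧
    (∀ i < r, (p i).natDegree ≤ m) ∧ stageField K θ r = E

theorem isStage_bot (m : ℕ) : IsStage k m (⊥ : IntermediateField K Ω) :=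
  ⟨0, fun _ => 0, fun _ => 0, ⟨by simp, by simp, by simp, by simp⟩, by simp, by simp [stageField]⟩

variable {k}

/-- The bound `m` records whether the quintic has been spent: a quintic may be adjoined only to a
stage built with degrees at most four. -/
theorem IsStage.exists_adjoin {m n : ℕ} {E : IntermediateField K Ω} (h : IsStage k m E)
    {P : Polynomial Ω} {x : Ω} (hP : IsOneParameterEquation k E P) (hn : P.natDegree ≤ n)
    (hx : P.IsRoot x) (hmn : m ≤ n) (hn5 : n ≤ 5) (hq : P.natDegree = 5 → m ≤ 4) :
    ∃ E', E ≤ E' ∧ IsStage k n E' ∧ x ∈ E' := by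
  obtain ⟨r, p, θ, hs, hm, rfl⟩ := h
  refine ⟨stageField K (Function.update θ r x) (r + 1), ?_, ⟨r + 1, Function.update p r P,
    Function.update θ r x, hs.update hP (hn.trans hn5) hx fun h i hi => ?_, fun i hi => ?_, rfl⟩, ?_⟩
  · rw [← stageField_update θ x le_rfl]
    exact stageField_mono _ (Nat.le_succ r)
  · have := hm i hi
    have := hq h
    omega
  · rcases Nat.lt_succ_iff_lt_or_eq.1 hi with hi | rfl
    · rw [Function.update_of_ne hi.ne]
      exact (hm i hi).trans hmn
    · simpa using hn
  · have := mem_stageField (K := K) (Function.update θ r x) (Nat.lt_succ_self r)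
    rwa [Function.update_self] at this

theorem IsStage.exists_adjoin_root {m n : ℕ} {E : IntermediateField K Ω} (h : IsStage k m E)
    {x : Ω} (hx : x ^ n ∈ E) (hn0 : 0 < n) (hnm : n ≤ m) (hn : n ≤ 4) (hm : m ≤ 5) :
    ∃ E', E ≤ E' ∧ IsStage k m E' ∧ x ∈ E' := by
  refine h.exists_adjoin (P := X ^ n - C (x ^ n)) ⟨monic_X_pow_sub_C _ hn0.ne', x ^ n, hx,
    fun i => ?_⟩ ?_ (by simp) le_rfl hm ?_
  · rw [coeff_sub, coeff_X_pow, coeff_C]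
    have h1 := IntermediateField.mem_adjoin_simple_self k (x ^ n)
    refine sub_mem ?_ ?_ <;> split_ifs
    exacts [one_mem _, zero_mem _, h1, zero_mem _]
  · rwa [natDegree_X_pow_sub_C]
  · rw [natDegree_X_pow_sub_C]
    omega

variable (k)

/-- The elements which can be reached from every stage containing `E` by auxiliary equations of
degree at most `m`. -/
def reachableField (m : ℕ) (E : IntermediateField K Ω) : IntermediateField K Ω where
  carrier := {x | ∀ E₁, E ≤ E₁ → IsStage k m E₁ → ∃ E₂, E₁ ≤ E₂ ∧ IsStage k m E₂ ∧ x ∈ E₂}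
  mul_mem' {x y} hx hy E₁ h h₁ := by
    obtain ⟨E₂, h12, h₂, hx⟩ := hx E₁ h h₁
    -- Reachability is demanded from every stage above `E`, so `y` can be reached after `x` without
    -- disturbing it; this makes the set a field.
    obtain ⟨E₃, h23, h₃, hy⟩ := hy E₂ (h.trans h12) h₂
    exact ⟨E₃, h12.trans h23, h₃, mul_mem (h23 hx) hy⟩
  add_mem' {x y} hx hy E₁ h h₁ := by
    obtain ⟨E₂, h12, h₂, hx⟩ := hx E₁ h h₁
    obtain ⟨E₃, h23, h₃, hy⟩ := hy E₂ (h.trans h12) h₂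
    exact ⟨E₃, h12.trans h23, h₃, add_mem (h23 hx) hy⟩
  algebraMap_mem' x E₁ _ h₁ := ⟨E₁, le_rfl, h₁, E₁.algebraMap_mem x⟩
  inv_mem' x hx E₁ h h₁ := by
    obtain ⟨E₂, h12, h₂, hx⟩ := hx E₁ h h₁
    exact ⟨E₂, h12, h₂, inv_mem hx⟩

theorem pow_mem_reachableField {m n : ℕ} {E : IntermediateField K Ω} {x : Ω}
    (hn0 : 0 < n) (hnm : n ≤ m) (hn : n ≤ 4) (hm : m ≤ 5) (hx : x ^ n ∈ reachableField k m E) :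
    x ∈ reachableField k m E := by
  intro E₁ h h₁
  obtain ⟨E₂, h12, h₂, hx⟩ := hx E₁ h h₁
  obtain ⟨E₃, h23, h₃, hx⟩ := h₂.exists_adjoin_root hx hn0 hnm hn hm
  exact ⟨E₃, h12.trans h23, h₃, hx⟩

theorem exists_isStage_of_forall_mem_reachableField {m : ℕ} {E : IntermediateField K Ω}
    (hE : IsStage k m E) {ι : Type*} (s : Finset ι) (x : ι → Ω)
    (hx : ∀ i ∈ s, x i ∈ reachableField k m E) :
    ∃ E₂, E ≤ E₂ ∧ IsStage k m E₂ ∧ ∀ i ∈ s, x i ∈ E₂ := by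
  classical
  induction s using Finset.induction_on with
  | empty => exact ⟨E, le_rfl, hE, by simp⟩
  | insert a s _ ih =>
    obtain ⟨E₂, h12, h₂, hs⟩ := ih fun i hi => hx i (Finset.mem_insert_of_mem hi)
    obtain ⟨E₃, h23, h₃, ha⟩ := hx a (Finset.mem_insert_self _ _) E₂ h12 h₂
    refine ⟨E₃, h12.trans h23, h₃, fun i hi => ?_⟩
    rcases Finset.mem_insert.1 hi with rfl | hi
    exacts [ha, h23 (hs i hi)]

variable (K) in
/-- Closedness of a subextension under square roots and cube roots. -/
def IsRadicalClosedIn (E : IntermediateField K Ω) : Prop :=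
  ∀ x : Ω, (x ^ 2 ∈ E → x ∈ E) ∧ (x ^ 3 ∈ E → x ∈ E)

theorem IsRadicalClosedIn.radicalClosed [IsAlgClosed Ω] {E : IntermediateField K Ω}
    (h : IsRadicalClosedIn K E) : RadicalClosed E where
  sqrt a := by
    obtain ⟨b, hb⟩ := IsAlgClosed.exists_pow_nat_eq (a : Ω) (n := 2) (by norm_num)
    exact ⟨⟨b, (h b).1 (hb ▸ a.2)⟩, Subtype.ext hb⟩
  cbrt a := by
    obtain ⟨b, hb⟩ := IsAlgClosed.exists_pow_nat_eq (a : Ω) (n := 3) (by norm_num)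
    exact ⟨⟨b, (h b).2 (hb ▸ a.2)⟩, Subtype.ext hb⟩

/-- The smallest subextension containing `E` which is closed under square and cube roots. -/
def radicalClosure (E : IntermediateField K Ω) : IntermediateField K Ω :=
  sInf {F | E ≤ F ∧ IsRadicalClosedIn K F}

theorem le_radicalClosure (E : IntermediateField K Ω) : E ≤ radicalClosure E :=
  le_sInf fun _ h => h.1

theorem radicalClosure_le {E F : IntermediateField K Ω} (h : E ≤ F) (hF : IsRadicalClosedIn K F) :
    radicalClosure E ≤ F := sInf_le ⟨h, hF⟩

theorem isRadicalClosedIn_radicalClosure (E : IntermediateField K Ω) :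
    IsRadicalClosedIn K (radicalClosure E) := by
  intro x
  simp only [radicalClosure, IntermediateField.mem_sInf]
  exact ⟨fun h F hF => (hF.2 x).1 (h F hF), fun h F hF => (hF.2 x).2 (h F hF)⟩

/-- The reachable elements form a field closed under square and cube roots, because `X^n - c`
depends only on `c`. Thus an element of the infinite closure costs only finitely many equations,
none of them a quintic. -/
theorem radicalClosure_le_reachableField {m : ℕ} (hm4 : 4 ≤ m) (hm5 : m ≤ 5)
    (E : IntermediateField K Ω) (hE : E ≤ reachableField k m E) :
    radicalClosure E ≤ reachableField k m E :=
  radicalClosure_le hE fun _ =>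
    ⟨pow_mem_reachableField k (by norm_num) (by omega) (by norm_num) hm5,
      pow_mem_reachableField k (by norm_num) (by omega) (by norm_num) hm5⟩

theorem le_reachableField (m : ℕ) (E : IntermediateField K Ω) : E ≤ reachableField k m E :=
  fun _ hx E₁ h h₁ => ⟨E₁, le_rfl, h₁, h hx⟩

end Stages

/-! ### Power sums of Galois stable multisets and Newton's identities -/

section PowerSums

variable {F Ω : Type*} [Field F] [Field Ω] [Algebra F Ω]

theorem exists_algebraMap_eq_of_forall_fixed [IsGalois F Ω] {x : Ω}
    (h : ∀ σ : Ω ≃ₐ[F] Ω, σ x = x) : ∃ c : F, algebraMap F Ω c = x :=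
  (InfiniteGalois.mem_range_algebraMap_iff_fixed x).2 h

theorem exists_algebraMap_eq_sum [IsGalois F Ω] {s : Multiset Ω}
    (hs : ∀ σ : Ω ≃ₐ[F] Ω, s.map σ = s) (P : F[X]) :
    ∃ c : F, algebraMap F Ω c = (s.map fun x => aeval x P).sum := by
  refine exists_algebraMap_eq_of_forall_fixed fun σ => ?_
  rw [map_multiset_sum, Multiset.map_map]
  conv_rhs => rw [← hs σ, Multiset.map_map]
  congr 1
  refine Multiset.map_congr rfl fun x _ => ?_
  simp [← aeval_algHom_apply]

/-- The linear functional `P ↦ ∑ P(x)`, where `x` runs through a Galois stable multiset. -/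
noncomputable def sumFunctional [IsGalois F Ω] (s : Multiset Ω) (hs : ∀ σ : Ω ≃ₐ[F] Ω, s.map σ = s) :
    F[X] →ₗ[F] F where
  toFun P := (exists_algebraMap_eq_sum hs P).choose
  map_add' P Q := by
    apply (algebraMap F Ω).injective
    rw [map_add, (exists_algebraMap_eq_sum hs (P + Q)).choose_spec,
      (exists_algebraMap_eq_sum hs P).choose_spec, (exists_algebraMap_eq_sum hs Q).choose_spec]
    simp [Multiset.sum_map_add]
  map_smul' c P := by
    apply (algebraMap F Ω).injective
    rw [smul_eq_mul, map_mul, (exists_algebraMap_eq_sum hs (c • P)).choose_spec, RingHom.id_apply,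
      (exists_algebraMap_eq_sum hs P).choose_spec]
    simp [Multiset.sum_map_mul_left, Algebra.smul_def]

theorem algebraMap_sumFunctional [IsGalois F Ω] (s : Multiset Ω)
    (hs : ∀ σ : Ω ≃ₐ[F] Ω, s.map σ = s) (P : F[X]) :
    algebraMap F Ω (sumFunctional s hs P) = (s.map fun x => aeval x P).sum :=
  (exists_algebraMap_eq_sum hs P).choose_spec

theorem exists_algebraMap_eq_coeff_prod [IsGalois F Ω] {s : Multiset Ω}
    (hs : ∀ σ : Ω ≃ₐ[F] Ω, s.map σ = s) (P : F[X]) (n : ℕ) :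
    ∃ c : F, algebraMap F Ω c = ((s.map fun x => X - C (aeval x P)).prod).coeff n := by
  refine exists_algebraMap_eq_of_forall_fixed fun σ => ?_
  have : ((s.map fun x => X - C (aeval x P)).prod).map (σ : Ω →+* Ω) =
      (s.map fun x => X - C (aeval x P)).prod := by
    rw [Polynomial.map_multiset_prod, Multiset.map_map]
    conv_rhs => rw [← hs σ, Multiset.map_map]
    congr 1
    refine Multiset.map_congr rfl fun x _ => ?_
    simp [← aeval_algHom_apply]
  conv_rhs => rw [← this, coeff_map]
  rfl

theorem map_aroots_eq [IsAlgClosed Ω] (f : F[X]) (σ : Ω ≃ₐ[F] Ω) :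
    (f.aroots Ω).map σ = f.aroots Ω := by
  have h := (IsAlgClosed.splits (f.map (algebraMap F Ω))).roots_map (σ : Ω →+* Ω)
  rw [Polynomial.map_map] at h
  have h2 : (σ : Ω →+* Ω).comp (algebraMap F Ω) = algebraMap F Ω := RingHom.ext fun x => by simp
  rw [h2] at h
  exact h.symm

/-- Newton's identities: vanishing power sums force the vanishing of the elementary symmetric
functions. -/
theorem coeff_prod_X_sub_C_eq_zero [CharZero Ω] (s : Multiset Ω) (m : ℕ)
    (h : ∀ j, 1 ≤ j → j ≤ m → (s.map (· ^ j)).sum = 0) (i : ℕ) (hi : i < s.card)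
    (hm : s.card ≤ i + m) : ((s.map fun x => X - C x).prod).coeff i = 0 := by
  obtain ⟨n, y, rfl⟩ : ∃ (n : ℕ) (y : Fin n → Ω), s = Finset.univ.val.map y := by
    induction s using Quotient.inductionOn with
    | h l => exact ⟨l.length, l.get, by simp⟩
  rw [Multiset.prod_X_sub_C_coeff _ hi.le]
  have hc : (Finset.univ.val.map y).card = n := by simp
  rw [hc] at hi hm ⊢
  rw [← MvPolynomial.aeval_esymm_eq_multiset_esymm (Fin n) ℤ]
  -- Newton's identity expresses `(n - i) e_{n-i}` through products, each containing a power sum of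
  -- index between 1 and `n - i ≤ m`; the factor `n - i` is invertible in characteristic zero.
  have hN := congrArg (MvPolynomial.aeval y) (MvPolynomial.mul_esymm_eq_sum (Fin n) ℤ (n - i))
  rw [map_mul, map_mul, map_sum, Finset.sum_eq_zero, mul_zero] at hN
  · have h0 : ((n - i : ℕ) : Ω) ≠ 0 := by
      have : n - i ≠ 0 := by omega
      exact_mod_cast this
    rw [map_natCast] at hN
    rw [(mul_eq_zero.1 hN).resolve_left h0, mul_zero]
  · intro a ha
    rw [Finset.mem_filter, Finset.HasAntidiagonal.mem_antidiagonal] at ha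
    have ha2 : a.1 < n - i := ha.2
    have := h a.2 (by omega) (by omega)
    rw [Multiset.map_map] at this
    have h2 : MvPolynomial.aeval y (MvPolynomial.psum (Fin n) ℤ a.2) = 0 := by
      rw [MvPolynomial.psum, map_sum, ← this]
      simp only [map_pow, MvPolynomial.aeval_X]
      rfl
    rw [map_mul, h2, mul_zero]

theorem coeff_prod_X_sub_C_aeval_eq_zero [CharZero Ω] [IsGalois F Ω] (s : Multiset Ω)
    (hs : ∀ σ : Ω ≃ₐ[F] Ω, s.map σ = s) (P : F[X]) (m : ℕ)
    (h : ∀ j, 1 ≤ j → j ≤ m → sumFunctional s hs (P ^ j) = 0) (i : ℕ) (hi : i < s.card)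
    (hm : s.card ≤ i + m) : ((s.map fun x => X - C (aeval x P)).prod).coeff i = 0 := by
  have := coeff_prod_X_sub_C_eq_zero (s.map fun x => aeval x P) m (fun j h1 h2 => by
    rw [Multiset.map_map, ← map_zero (algebraMap F Ω), ← h j h1 h2, algebraMap_sumFunctional]
    simp) i (by simpa using hi) (by simpa using hm)
  rwa [Multiset.map_map] at this

end PowerSums

/-! ### Reducing a quintic to a one-parameter quintic -/

section Quintic

variable {F Ω : Type*} [Field F] [Field Ω] [Algebra F Ω]

theorem finrank_degreeLT (n : ℕ) : Module.finrank F (degreeLT F n) = n := by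
  rw [(degreeLTEquiv F n).finrank_eq, Module.finrank_fin_fun]

/-- Over a radical closed field, an irreducible quintic has the same splitting behaviour as a
trinomial quintic `y⁵ + a y + b`. -/
theorem exists_bring_jerrard [CharZero F] [IsAlgClosed Ω] [IsGalois F Ω] (hF : RadicalClosed F)
    {D : F[X]} (hD : Irreducible D) (h5 : D.natDegree = 5) {α : Ω} (hα : aeval α D = 0) :
    ∃ (y : Ω) (a b : F), y ^ 5 + algebraMap F Ω a * y + algebraMap F Ω b = 0 ∧
      α ∈ IntermediateField.adjoin F {y} := by
  have : CharZero Ω := charZero_of_injective_algebraMap (algebraMap F Ω).injective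
  have hs := map_aroots_eq (Ω := Ω) D
  have hcard : (D.aroots Ω).card = 5 := by
    rw [← h5, ← natDegree_map (algebraMap F Ω)]
    exact (IsAlgClosed.splits _).natDegree_eq_card_roots.symm
  have hαs : α ∈ D.aroots Ω := (mem_aroots.2 ⟨hD.ne_zero, hα⟩)
  obtain ⟨⟨P, hP⟩, hP0, hP1, hP2, hP3⟩ := exists_map_pow_le_three_eq_zero hF
    (sumFunctional (D.aroots Ω) hs) (degreeLT F 5).subtype (finrank_degreeLT 5).ge
  simp only [Submodule.subtype_apply] at hP1 hP2 hP3
  have hz := coeff_prod_X_sub_C_aeval_eq_zero (D.aroots Ω) hs P 3 (fun j h1 h3 => by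
    interval_cases j
    · rwa [pow_one]
    · exact hP2
    · exact hP3)
  rw [hcard] at hz
  obtain ⟨a, ha⟩ := exists_algebraMap_eq_coeff_prod hs P 1
  obtain ⟨b, hb⟩ := exists_algebraMap_eq_coeff_prod hs P 0
  have hα_int : IsIntegral F α := Algebra.IsIntegral.isIntegral α
  have hmin : (minpoly F α).natDegree = 5 := by
    rw [minpoly.eq_of_irreducible hD hα |>.symm, natDegree_mul_C (by simp [hD.ne_zero]), h5]
  have hdeg : P.natDegree < 5 := by
    rcases eq_or_ne P 0 with rfl | h
    · simp
    · exact (natDegree_lt_iff_degree_lt h).2 (mem_degreeLT.1 hP)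
  refine ⟨aeval α P, a, b, ?_, ?_⟩
  · set Q := ((D.aroots Ω).map fun x => X - C (aeval x P)).prod with hQ
    have hQm : Q.Monic := monic_multiset_prod_of_monic _ _ fun x _ => monic_X_sub_C _
    have hQd : Q.natDegree = 5 := by
      rw [hQ, natDegree_multiset_prod_of_monic _ (by
        simp only [Multiset.mem_map]
        rintro _ ⟨x, -, rfl⟩
        exact monic_X_sub_C _)]
      simp [hcard]
    have hQα : Q.eval (aeval α P) = 0 := by
      rw [hQ, eval_multiset_prod, Multiset.map_map]
      exact Multiset.prod_eq_zero (Multiset.mem_map.2 ⟨α, hαs, by simp⟩)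
    have h5c : Q.coeff 5 = 1 := by
      rw [← hQd]
      exact hQm
    rw [eval_eq_sum_range, hQd] at hQα
    simp only [Finset.sum_range_succ, Finset.sum_range_zero, hz 2 (by norm_num) (by norm_num),
      hz 3 (by norm_num) (by norm_num), hz 4 (by norm_num) (by norm_num), h5c] at hQα
    rw [ha, hb]
    linear_combination hQα
  -- The degree of `F(P(α))` divides 5. If it is 1, then `P` is a constant `c`, since `α` has degree
  -- 5 and `P` degree below 5; the vanishing first power sum `5c` then gives `P = 0`. So it is 5,
  -- and `F(P(α)) = F(α)`.
  · have hle : IntermediateField.adjoin F {aeval α P} ≤ IntermediateField.adjoin F {α} := by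
      rw [IntermediateField.adjoin_simple_le_iff]
      exact IntermediateField.algebra_adjoin_le_adjoin F _ (aeval_mem_adjoin_singleton F α)
    have hfα : Module.finrank F (IntermediateField.adjoin F {α}) = 5 := by
      rw [IntermediateField.adjoin.finrank hα_int, hmin]
    have hfd : FiniteDimensional F (IntermediateField.adjoin F {α}) :=
      IntermediateField.adjoin.finiteDimensional hα_int
    have hdvd := IntermediateField.finrank_dvd_of_le_right hle
    rw [hfα] at hdvd
    rcases (Nat.dvd_prime Nat.prime_five).1 hdvd with h | h
    · exfalso
      rw [IntermediateField.finrank_eq_one_iff] at h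
      have hy := IntermediateField.mem_adjoin_simple_self F (aeval α P)
      rw [h, IntermediateField.mem_bot] at hy
      obtain ⟨c, hc⟩ := hy
      have hPc : P = C c := by
        by_contra hne
        have h1 := natDegree_le_natDegree
          (minpoly.degree_le_of_ne_zero F α (sub_ne_zero.2 hne) (by simp [hc]))
        rw [hmin, natDegree_sub_C] at h1
        omega
      have h1 := algebraMap_sumFunctional (D.aroots Ω) hs P
      rw [hP1, hPc] at h1
      have h2 : algebraMap F Ω c = 0 := by
        simp [hcard] at h1
        linear_combination -h1 / 5
      have h3 : c = 0 := by simpa using h2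
      exact hP0 (by simp [hPc, h3])
    · rw [IntermediateField.eq_of_le_of_finrank_eq hle (h.trans hfα.symm)]
      exact IntermediateField.mem_adjoin_simple_self F α

/-- A proper factor has degree between one and four, hence a root. -/
theorem exists_root_of_not_irreducible [CharZero F] (hF : RadicalClosed F) {D : F[X]}
    (h5 : D.natDegree = 5) (hD : ¬ Irreducible D) : ∃ x, D.eval x = 0 := by
  have hu : ¬ IsUnit D := fun h => by
    rw [natDegree_eq_zero_of_isUnit h] at h5
    omega
  have h0 : D ≠ 0 := by
    rintro rfl
    simp at h5
  rw [irreducible_iff] at hD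
  push Not at hD
  obtain ⟨a, b, rfl, ha, hb⟩ := hD hu
  rw [natDegree_mul (left_ne_zero_of_mul h0) (right_ne_zero_of_mul h0)] at h5
  have ha1 : a.natDegree ≠ 0 := fun h => ha (by
    rw [eq_C_of_natDegree_eq_zero h] at h0 ⊢
    exact isUnit_C.2 (isUnit_iff_ne_zero.2 fun hc => h0 (by simp [hc])))
  have hb1 : b.natDegree ≠ 0 := fun h => hb (by
    rw [eq_C_of_natDegree_eq_zero h] at h0 ⊢
    exact isUnit_C.2 (isUnit_iff_ne_zero.2 fun hc => h0 (by simp [hc])))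
  obtain ⟨x, hx⟩ := hF.exists_root (p := a) (by omega) (by omega)
  exact ⟨x, by simp [hx]⟩

variable (k : Type*) {K : Type*} [Field k] [Field K] [Algebra k Ω] [Algebra K Ω]

/-- A quintic with coefficients in the radical closure of the ground field acquires a root after
the solution of a single one-parameter quintic. -/
theorem exists_radicalClosed_quintic_root [CharZero K] [IsAlgClosed Ω] [IsGalois K Ω]
    (L₀ : IntermediateField K Ω) (hL₀ : L₀ = radicalClosure ⊥) (D : L₀[X])
    (h5 : D.natDegree = 5) :
    ∃ L : IntermediateField K Ω, L₀ ≤ L ∧ IsRadicalClosedIn K L ∧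
      (∃ E, IsStage k 5 E ∧ L ≤ reachableField k 5 E) ∧ ∃ x ∈ L, aeval x D = 0 := by
  have hcl : IsRadicalClosedIn K L₀ := hL₀ ▸ isRadicalClosedIn_radicalClosure _
  have hrc : RadicalClosed L₀ := hcl.radicalClosed
  have hreach : ∀ m, 4 ≤ m → m ≤ 5 → ∀ E : IntermediateField K Ω,
      radicalClosure E ≤ reachableField k m E := fun m h4 h5 E =>
    radicalClosure_le_reachableField k h4 h5 E (le_reachableField k m E)
  by_cases hroot : ∃ x, D.eval x = 0
  · obtain ⟨x, hx⟩ := hroot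
    refine ⟨L₀, le_rfl, hcl, ⟨⊥, isStage_bot k 5, hL₀ ▸ hreach 5 (by norm_num) le_rfl ⊥⟩, x, x.2, ?_⟩
    have := aeval_algebraMap_apply Ω x D
    rw [coe_aeval_eq_eval, hx, map_zero] at this
    exact this
  have hirr : Irreducible D := by
    by_contra h
    exact hroot (exists_root_of_not_irreducible hrc h5 h)
  obtain ⟨α, hα⟩ := IsAlgClosed.exists_aeval_eq_zero Ω D
    (by rw [degree_eq_natDegree hirr.ne_zero, h5]; norm_num)
  obtain ⟨y, a, b, hy, hαy⟩ := exists_bring_jerrard hrc hirr h5 hα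
  -- Setting `y = sθ` with `s⁴ = a` normalizes the linear coefficient to 1. If `a = 0` no scaling is
  -- needed, and `e = 0` records that the linear term is absent.
  obtain ⟨s, t, e, θ, he, hθ, hs⟩ : ∃ (s t : L₀) (e : ℕ) (θ : Ω), e ≤ 1 ∧
      θ ^ 5 + e * θ + algebraMap L₀ Ω t = 0 ∧ y = algebraMap L₀ Ω s * θ := by
    by_cases ha : a = 0
    · exact ⟨1, b, 0, y, zero_le_one, by simpa [ha] using hy, by simp⟩
    · obtain ⟨s₁, hs₁⟩ := hrc.sqrt a
      obtain ⟨s, rfl⟩ := hrc.sqrt s₁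
      have hs0 : s ≠ 0 := by
        rintro rfl
        exact ha (by simp [← hs₁])
      have hs0' : algebraMap L₀ Ω s ≠ 0 := by simpa using hs0
      refine ⟨s, b / s ^ 5, 1, y / algebraMap L₀ Ω s, le_rfl, ?_, by field_simp⟩
      rw [← hs₁] at hy
      simp only [map_pow, map_div₀, Nat.cast_one] at hy ⊢
      field_simp
      linear_combination hy
  have ht : (t : Ω) ∈ radicalClosure (⊥ : IntermediateField K Ω) := hL₀ ▸ t.2
  -- The parameter is reached with degrees at most 4, so that the quintic for `θ` is the first one.
  obtain ⟨E₀, -, hE₀, htE₀⟩ := hreach 4 le_rfl (by norm_num) ⊥ ht ⊥ le_rfl (isStage_bot k 4)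
  have hdeg : (X ^ 5 + (e : Polynomial Ω) * X + C (t : Ω)).natDegree = 5 := by
    interval_cases e
    · simp
    · have : (X ^ 5 + ((1 : ℕ) : Polynomial Ω) * X + C (t : Ω)) = X ^ 5 + (X + C (t : Ω)) := by
        push_cast
        ring
      rw [this, natDegree_add_eq_left_of_natDegree_lt] <;> simp
  have hone : IsOneParameterEquation k E₀ (X ^ 5 + (e : Polynomial Ω) * X + C (t : Ω)) := by
    refine ⟨?_, t, htE₀, fun n => ?_⟩
    · rw [Monic, leadingCoeff, hdeg]
      simp
    · have h1 := IntermediateField.mem_adjoin_simple_self k (t : Ω)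
      rw [coeff_add, coeff_add, coeff_X_pow, coeff_natCast_mul, coeff_X, coeff_C]
      refine add_mem (add_mem ?_ (mul_mem (natCast_mem _ _) ?_)) ?_ <;> split_ifs
      exacts [one_mem _, zero_mem _, one_mem _, zero_mem _, h1, zero_mem _]
  obtain ⟨E₁, h01, hE₁, hθE₁⟩ := hE₀.exists_adjoin (n := 5) (x := θ) hone hdeg.le (by
    simpa using hθ) (by norm_num) le_rfl (fun _ => le_rfl)
  have hle : L₀ ≤ radicalClosure E₁ :=
    hL₀ ▸ radicalClosure_le bot_le (isRadicalClosedIn_radicalClosure E₁)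
  refine ⟨radicalClosure E₁, hle, isRadicalClosedIn_radicalClosure E₁,
    ⟨E₁, hE₁, hreach 5 (by norm_num) le_rfl E₁⟩, α, ?_, hα⟩
  have hyL : y ∈ radicalClosure E₁ := by
    rw [hs]
    exact mul_mem (hle s.2) (le_radicalClosure E₁ hθE₁)
  have hadj : IntermediateField.adjoin L₀ {y} ≤ IntermediateField.extendScalars hle := by
    rw [IntermediateField.adjoin_simple_le_iff]
    exact hyL
  exact hadj hαy

end Quintic

/-! ### The line on which only the quartic condition remains -/

section Nonic

variable {F L : Type*} [Field F] [Field L] [Algebra F L] {n : ℕ}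

/-- The polynomial with the given coefficients. -/
noncomputable def coeffsToPoly (F : Type*) [Field F] (n : ℕ) : (Fin n → F) →ₗ[F] F[X] :=
  Fintype.linearCombination F fun i => X ^ (i : ℕ)

theorem coeffsToPoly_apply (a : Fin n → F) : coeffsToPoly F n a = ∑ i, C (a i) * X ^ (i : ℕ) := by
  simp [coeffsToPoly, Fintype.linearCombination_apply, smul_eq_C_mul]

theorem map_coeffsToPoly (a : Fin n → F) :
    (coeffsToPoly F n a).map (algebraMap F L) = coeffsToPoly L n (algebraMap F L ∘ a) := by
  simp [coeffsToPoly_apply, Polynomial.map_sum]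

/-- The discriminant polynomial of the pencil generated by the forms `l (x y)` and `l (p x y)` on
the space parametrized by `g`. -/
noncomputable def pencilPoly (l : F[X] →ₗ[F] F) (p : Fin n → F)
    (g : (Fin 5 → F) →ₗ[F] (Fin n → F)) : F[X] :=
  ((X : F[X]) • (LinearMap.toMatrix₂' F ((weightedForm l 1).compl₁₂ (coeffsToPoly F n ∘ₗ g)
      (coeffsToPoly F n ∘ₗ g))).map C +
    (LinearMap.toMatrix₂' F ((weightedForm l (coeffsToPoly F n p)).compl₁₂ (coeffsToPoly F n ∘ₗ g)
      (coeffsToPoly F n ∘ₗ g))).map C).det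

theorem linearIndependent_of_disjoint {V : Type*} [AddCommGroup V] [Module F V] {p : V}
    {g : (Fin n → F) →ₗ[F] V} (h : ∀ (s : F) c, s • p + g c = 0 → s = 0 ∧ c = 0) :
    LinearIndependent F (Fin.cons p fun i => g (Pi.single i 1) : Fin (n + 1) → V) := by
  rw [Fintype.linearIndependent_iff]
  intro c hc
  rw [Fin.sum_univ_succ] at hc
  have : ∑ i : Fin n, c i.succ • g (Pi.single i 1) = g fun i => c i.succ := by
    conv_rhs => rw [← Finset.univ_sum_single (fun i : Fin n => c i.succ), map_sum]
    refine Finset.sum_congr rfl fun i _ => ?_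
    rw [← map_smul, ← Pi.single_smul, smul_eq_mul, mul_one]
  simp only [Fin.cons_zero, Fin.cons_succ, this] at hc
  obtain ⟨h0, h1⟩ := h _ _ hc
  intro i
  refine Fin.cases h0 (fun j => congrFun h1 j) i

/-- All coefficients of the binary forms `l((s x + t y)^j)`, `j ≤ 3`, vanish by hypothesis, so only
the binary quartic is left to solve. -/
theorem exists_map_pow_le_four_eq_zero_of_line {A : Type*} [CommRing A] [Algebra L A] [CharZero L]
    (hL : RadicalClosed L) (l : A →ₗ[L] L) (x y : A)
    (hx1 : l x = 0) (hx2 : l (x ^ 2) = 0) (hx3 : l (x ^ 3) = 0)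
    (hy1 : l y = 0) (hy2 : l (y ^ 2) = 0) (hy3 : l (y ^ 3) = 0)
    (hxy : l (x * y) = 0) (hx2y : l (x ^ 2 * y) = 0) (hxy2 : l (x * y ^ 2) = 0) :
    ∃ s t : L, (s ≠ 0 ∨ t ≠ 0) ∧ ∀ j, 1 ≤ j → j ≤ 4 → l ((s • x + t • y) ^ j) = 0 := by
  obtain ⟨s, t, hst, h4⟩ := exists_map_fourth_pow_eq_zero hL l x y
  refine ⟨s, t, hst, fun j h1 hj => ?_⟩
  interval_cases j
  · simp [hx1, hy1]
  · have : (s • x + t • y) ^ 2 = s ^ 2 • x ^ 2 + (2 * s * t) • (x * y) + t ^ 2 • y ^ 2 := by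
      simp only [Algebra.smul_def, map_mul, map_pow, map_ofNat]
      ring
    rw [this]
    simp [hx2, hxy, hy2]
  · have : (s • x + t • y) ^ 3 = s ^ 3 • x ^ 3 + (3 * s ^ 2 * t) • (x ^ 2 * y) +
        (3 * s * t ^ 2) • (x * y ^ 2) + t ^ 3 • y ^ 3 := by
      simp only [Algebra.smul_def, map_mul, map_pow, map_ofNat]
      ring
    rw [this]
    simp [hx3, hx2y, hxy2, hy3]
  · exact h4

/-- A common zero of two quadratic forms and a cubic form, given that the pencil of the two
quadratic forms has a singular member. -/
theorem exists_common_zero_two_quadrics_cubic {A : Type*} [CommRing A] [Algebra L A] [CharZero L]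
    (hL : RadicalClosed L) (l : A →ₗ[L] L) (x : A) (f : (Fin 5 → L) →ₗ[L] A) (μ ν : L)
    (hμν : μ ≠ 0 ∨ ν ≠ 0)
    (hdet : (μ • LinearMap.toMatrix₂' L ((weightedForm l 1).compl₁₂ f f) +
      ν • LinearMap.toMatrix₂' L ((weightedForm l x).compl₁₂ f f)).det = 0) :
    ∃ v ≠ 0, l (f v ^ 2) = 0 ∧ l (f v ^ 3) = 0 ∧ l (x * f v ^ 2) = 0 := by
  obtain ⟨c, d, hcd, ⟨hA1, hA2, hA3⟩, hB1, hB2, hB3⟩ := exists_common_isotropic_plane hL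
    ((weightedForm l 1).compl₁₂ f f) ((weightedForm l x).compl₁₂ f f)
    (fun x y => by simp [mul_comm]) (fun x y => by simp [mul_comm (f x)]) μ ν hμν hdet
  simp only [LinearMap.compl₁₂_apply, weightedForm_apply, one_mul] at hA1 hA2 hA3 hB1 hB2 hB3
  obtain ⟨s, t, hst, h3⟩ := exists_map_cube_eq_zero hL l (f c) (f d)
  have hsq : f (s • c + t • d) ^ 2 =
      s ^ 2 • (f c * f c) + (2 * s * t) • (f c * f d) + t ^ 2 • (f d * f d) := by
    rw [map_add, map_smul, map_smul]
    simp only [Algebra.smul_def, map_mul, map_pow, map_ofNat]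
    ring
  refine ⟨s • c + t • d, fun h => ?_, ?_, ?_, ?_⟩
  · have := LinearIndependent.pair_iff.1 hcd s t h
    tauto
  · rw [hsq]
    simp [hA1, hA2, hA3]
  · rw [map_add, map_smul, map_smul, h3]
  · rw [hsq]
    simp [mul_add, hB1, hB2, hB3]

/-- A common zero of the power sums of degree at most four, after the pencil of quadratic forms has
acquired a singular member. -/
theorem exists_map_pow_le_four_eq_zero [CharZero L] (hL : RadicalClosed L)
    (l : F[X] →ₗ[F] F) (l' : L[X] →ₗ[L] L)
    (hl : ∀ P : F[X], l' (P.map (algebraMap F L)) = algebraMap F L (l P))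
    (p : Fin n → F) (g : (Fin 5 → F) →ₗ[F] (Fin n → F))
    (hp : l (coeffsToPoly F n p) = 0 ∧ l (coeffsToPoly F n p ^ 2) = 0 ∧
      l (coeffsToPoly F n p ^ 3) = 0)
    (hg : ∀ c, l (coeffsToPoly F n (g c)) = 0 ∧
      l (coeffsToPoly F n p * coeffsToPoly F n (g c)) = 0 ∧
      l (coeffsToPoly F n p ^ 2 * coeffsToPoly F n (g c)) = 0)
    (hpg : ∀ (s : F) c, s • p + g c = 0 → s = 0 ∧ c = 0)
    (hroot : (pencilPoly l p g).natDegree = 5 → ∃ x : L, aeval x (pencilPoly l p g) = 0) :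
    ∃ a : Fin n → L, a ≠ 0 ∧ ∀ j, 1 ≤ j → j ≤ 4 → l' (coeffsToPoly L n a ^ j) = 0 := by
  obtain ⟨p', hp'⟩ : ∃ p' : Fin n → L, p' = algebraMap F L ∘ p := ⟨_, rfl⟩
  obtain ⟨u', hu'⟩ : ∃ u' : Fin 5 → Fin n → L, ∀ i, u' i = algebraMap F L ∘ g (Pi.single i 1) :=
    ⟨_, fun _ => rfl⟩
  obtain ⟨g', hg'⟩ : ∃ g' : (Fin 5 → L) →ₗ[L] (Fin n → L), g' = Fintype.linearCombination L u' :=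
    ⟨_, rfl⟩
  -- The point and directions live over `F`, so that the discriminant has coefficients there, while
  -- its root lies in `L`. Linear independence survives the extension of scalars.
  have hind : ∀ (s : L) c, s • p' + g' c = 0 → s = 0 ∧ c = 0 := by
    obtain ⟨w, hw⟩ : ∃ w : Fin 6 → Fin n → F, w = Fin.cons p fun i => g (Pi.single i 1) := ⟨_, rfl⟩
    have h0 : LinearIndependent F w := hw ▸ linearIndependent_of_disjoint hpg
    have h1 : LinearIndependent L (fun i => algebraMap F L ∘ w i) :=
      linearIndependent_algebraMap_comp_iff.2 h0
    rw [Fintype.linearIndependent_iff] at h1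
    intro s c h
    have h2 := h1 (Fin.cons s c) (by
      rw [Fin.sum_univ_succ]
      simpa [hw, hg', hp', hu', Fintype.linearCombination_apply] using h)
    exact ⟨by simpa using h2 0, funext fun i => by simpa using h2 i.succ⟩
  have hg'c : ∀ c, coeffsToPoly L n (g' c) = ∑ i, c i • coeffsToPoly L n (u' i) := by
    intro c
    simp [hg', Fintype.linearCombination_apply, map_sum]
  have hsingle : ∀ i, g' (Pi.single i 1) = u' i := fun i => by
    simp [hg', Fintype.linearCombination_apply_single]
  have hlu : ∀ q : F[X], (∀ c, l (q * coeffsToPoly F n (g c)) = 0) →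
      ∀ c, l' (q.map (algebraMap F L) * coeffsToPoly L n (g' c)) = 0 := by
    intro q hq c
    rw [hg'c, Finset.mul_sum, map_sum]
    refine Finset.sum_eq_zero fun i _ => ?_
    rw [mul_smul_comm, map_smul, hu', ← map_coeffsToPoly, ← Polynomial.map_mul, hl, hq, map_zero,
      smul_zero]
  have hmat : ∀ q : F[X], LinearMap.toMatrix₂' L ((weightedForm l' (q.map (algebraMap F L))).compl₁₂
      (coeffsToPoly L n ∘ₗ g') (coeffsToPoly L n ∘ₗ g')) =
      (LinearMap.toMatrix₂' F ((weightedForm l q).compl₁₂ (coeffsToPoly F n ∘ₗ g)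
      (coeffsToPoly F n ∘ₗ g))).map (algebraMap F L) := by
    intro q
    ext i j
    simp only [LinearMap.toMatrix₂'_apply, Matrix.map_apply, LinearMap.compl₁₂_apply,
      LinearMap.comp_apply, weightedForm_apply, hsingle, hu']
    rw [← hl, Polynomial.map_mul, Polynomial.map_mul, map_coeffsToPoly, map_coeffsToPoly]
  obtain ⟨A', hA'⟩ : ∃ A', A' = (weightedForm l' 1).compl₁₂ (coeffsToPoly L n ∘ₗ g')
    (coeffsToPoly L n ∘ₗ g') := ⟨_, rfl⟩
  obtain ⟨B', hB'⟩ : ∃ B', B' = (weightedForm l' (coeffsToPoly L n p')).compl₁₂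
    (coeffsToPoly L n ∘ₗ g') (coeffsToPoly L n ∘ₗ g') := ⟨_, rfl⟩
  have hmatA := hmat 1
  have hmatB := hmat (coeffsToPoly F n p)
  rw [Polynomial.map_one, ← hA'] at hmatA
  rw [map_coeffsToPoly, ← hp', ← hB'] at hmatB
  have hpoly : ((X : L[X]) • (LinearMap.toMatrix₂' L A').map C +
      (LinearMap.toMatrix₂' L B').map C).det = (pencilPoly l p g).map (algebraMap F L) := by
    rw [pencilPoly, ← coe_mapRingHom, RingHom.map_det, hmatA, hmatB]
    congr 1
    ext i j : 2
    simp
  -- The discriminant over `L` is the image of `pencilPoly`, so the root assumed in degree five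
  -- suffices; lower degree means a singular member at infinity.
  obtain ⟨μ, ν, hμν, hdet⟩ := exists_det_pencil_eq_zero (LinearMap.toMatrix₂' L A')
    (LinearMap.toMatrix₂' L B') (fun h => by
      rw [hpoly] at h ⊢
      rw [natDegree_map] at h
      obtain ⟨x, hx⟩ := hroot h
      exact ⟨x, by rwa [eval_map_algebraMap]⟩)
  obtain ⟨x, hx⟩ : ∃ x, x = coeffsToPoly L n p' := ⟨_, rfl⟩
  rw [hA', hB'] at hdet
  obtain ⟨v, hv0, hy2, hy3, hxy2⟩ := exists_common_zero_two_quadrics_cubic hL l'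
    (coeffsToPoly L n p') (coeffsToPoly L n ∘ₗ g') μ ν hμν hdet
  obtain ⟨y, hy⟩ : ∃ y, y = coeffsToPoly L n (g' v) := ⟨_, rfl⟩
  rw [LinearMap.comp_apply, ← hy] at hy2 hy3 hxy2
  rw [← hx] at hxy2
  have hy1 : l' y = 0 := by
    simpa [hy] using hlu 1 (fun c => by simpa using (hg c).1) v
  have hxy : l' (x * y) = 0 := by
    have := hlu _ (fun c => (hg c).2.1) v
    rwa [map_coeffsToPoly, ← hp', ← hx, ← hy] at this
  have hx2y : l' (x ^ 2 * y) = 0 := by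
    have := hlu _ (fun c => (hg c).2.2) v
    rwa [Polynomial.map_pow, map_coeffsToPoly, ← hp', ← hx, ← hy] at this
  have hx1 : l' x = 0 := by
    rw [hx, hp', ← map_coeffsToPoly, hl, hp.1, map_zero]
  have hx2 : l' (x ^ 2) = 0 := by
    rw [hx, hp', ← map_coeffsToPoly, ← Polynomial.map_pow, hl, hp.2.1, map_zero]
  have hx3 : l' (x ^ 3) = 0 := by
    rw [hx, hp', ← map_coeffsToPoly, ← Polynomial.map_pow, hl, hp.2.2, map_zero]
  obtain ⟨s, t, hst, h⟩ := exists_map_pow_le_four_eq_zero_of_line hL l' x y hx1 hx2 hx3 hy1 hy2 hy3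
    hxy hx2y hxy2
  refine ⟨s • p' + t • g' v, fun h0 => ?_, fun j h1 hj => ?_⟩
  · rw [← map_smul] at h0
    obtain ⟨h1, h2⟩ := hind _ _ h0
    exact hst.elim (fun hs => hs h1) fun ht => ht ((smul_eq_zero.1 h2).resolve_right hv0)
  · rw [map_add, map_smul, map_smul, ← hx, ← hy]
    exact h j h1 hj

end Nonic

/-! ### Vanishing of four power sums over a finite stage -/

section Reduction

variable (k : Type*) {K Ω : Type*} [Field k] [Field K] [Field Ω] [Algebra k Ω] [Algebra K Ω]

theorem map_aroots_eq_of_intermediateField [IsAlgClosed Ω] (f : K[X]) (L : IntermediateField K Ω)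
    (σ : Ω ≃ₐ[L] Ω) : (f.aroots Ω).map σ = f.aroots Ω :=
  map_aroots_eq f (σ.restrictScalars K)

/-- A nonzero Tschirnhaus substitution for which the first four power sums of the transformed roots
vanish, with coefficients in the last field of a system of auxiliary equations. -/
theorem exists_tschirnhaus_power_sums_eq_zero [CharZero K] [IsAlgClosed Ω] [IsGalois K Ω]
    (f : K[X]) :
    ∃ (E : IntermediateField K Ω) (a : Fin 9 → E), IsStage k 5 E ∧ a ≠ 0 ∧
      ∀ j, 1 ≤ j → j ≤ 4 →
        sumFunctional (f.aroots Ω) (map_aroots_eq_of_intermediateField f E)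
          (coeffsToPoly E 9 a ^ j) = 0 := by
  obtain ⟨L₀, hL₀⟩ : ∃ L₀ : IntermediateField K Ω, L₀ = radicalClosure ⊥ := ⟨_, rfl⟩
  have hcl : IsRadicalClosedIn K L₀ := hL₀ ▸ isRadicalClosedIn_radicalClosure _
  obtain ⟨p, g, hp, hg, hpg⟩ := exists_point_and_tangent_directions hcl.radicalClosed
    (sumFunctional (f.aroots Ω) (map_aroots_eq_of_intermediateField f L₀)) (coeffsToPoly L₀ 9)
    (by simp)
  obtain ⟨D, hD⟩ : ∃ D, D = pencilPoly (sumFunctional (f.aroots Ω)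
    (map_aroots_eq_of_intermediateField f L₀)) p g := ⟨_, rfl⟩
  obtain ⟨L, hle, hLcl, ⟨E, hE, hLE⟩, hroot⟩ : ∃ L : IntermediateField K Ω, L₀ ≤ L ∧
      IsRadicalClosedIn K L ∧ (∃ E, IsStage k 5 E ∧ L ≤ reachableField k 5 E) ∧
      (D.natDegree = 5 → ∃ x ∈ L, aeval x D = 0) := by
    by_cases h5 : D.natDegree = 5
    · obtain ⟨L, h1, h2, h3, h4⟩ := exists_radicalClosed_quintic_root k L₀ hL₀ D h5
      exact ⟨L, h1, h2, h3, fun _ => h4⟩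
    · exact ⟨L₀, le_rfl, hcl, ⟨⊥, isStage_bot k 5, hL₀ ▸ radicalClosure_le_reachableField k
        (by norm_num) le_rfl ⊥ (le_reachableField k 5 ⊥)⟩, fun h => absurd h h5⟩
  let _ : Algebra L₀ L := (IntermediateField.inclusion hle).toRingHom.toAlgebra
  have : IsScalarTower L₀ L Ω := IsScalarTower.of_algebraMap_eq fun _ => rfl
  obtain ⟨a, ha0, ha⟩ := exists_map_pow_le_four_eq_zero hLcl.radicalClosed
    (sumFunctional (f.aroots Ω) (map_aroots_eq_of_intermediateField f L₀))
    (sumFunctional (f.aroots Ω) (map_aroots_eq_of_intermediateField f L))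
    (fun P => by
      apply (algebraMap L Ω).injective
      rw [algebraMap_sumFunctional, ← IsScalarTower.algebraMap_apply, algebraMap_sumFunctional]
      simp only [aeval_map_algebraMap]) p g hp hg hpg
    (fun h => by
      rw [← hD] at h ⊢
      obtain ⟨x, hxL, hx⟩ := hroot h
      refine ⟨⟨x, hxL⟩, (algebraMap L Ω).injective ?_⟩
      rw [← aeval_algebraMap_apply, map_zero]
      exact hx)
  -- The substitution was found over the infinite extension `L`; its nine coefficients are
  -- reachable, so one finite stage contains them all.
  obtain ⟨E', -, hE', haE⟩ := exists_isStage_of_forall_mem_reachableField k hE Finset.univ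
    (fun i => (a i : Ω)) fun i _ => hLE (a i).2
  refine ⟨E', fun i => ⟨a i, haE i (Finset.mem_univ i)⟩, hE', fun h => ha0 (funext fun i => ?_),
    fun j h1 h4 => ?_⟩
  · have := congrFun h i
    exact Subtype.ext (congrArg (algebraMap E' Ω) this)
  · apply (algebraMap E' Ω).injective
    have := congrArg (algebraMap L Ω) (ha j h1 h4)
    rw [algebraMap_sumFunctional, map_zero] at this ⊢
    rw [← this]
    congr 1
    refine Multiset.map_congr rfl fun x _ => ?_
    simp only [map_pow, coeffsToPoly_apply, map_sum, map_mul, aeval_C, aeval_X]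
    rfl

end Reduction

/-! ### Powers of automorphisms fixing the tower -/

section GaloisAction

variable {k K Ω : Type*} [Field k] [Field K] [Field Ω] [Algebra k K] [Algebra k Ω] [Algebra K Ω]
  [IsScalarTower k K Ω]

theorem IsOneParameterEquation.coeff_mem {E : IntermediateField K Ω} {p : Polynomial Ω}
    (h : IsOneParameterEquation k E p) (n : ℕ) : p.coeff n ∈ E := by
  obtain ⟨-, t, ht, hp⟩ := h
  have hle : IntermediateField.adjoin k {t} ≤ E.restrictScalars k := by
    rw [IntermediateField.adjoin_simple_le_iff]
    exact ht
  exact hle (hp n)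

/-- The power `120 = 5!` of an automorphism fixes the roots of the equations of degree at most five
which it preserves. -/
theorem pow_apply_eq_self_of_isRoot {τ : Ω ≃ₐ[K] Ω} {p : Polynomial Ω} (hp : p ≠ 0)
    (h5 : p.natDegree ≤ 5) (hτ : ∀ n, τ (p.coeff n) = p.coeff n) {x : Ω} (hx : p.IsRoot x) :
    (τ ^ 120) x = x := by
  classical
  have hmap : p.map (τ : Ω →+* Ω) = p := by
    ext n
    rw [coeff_map]
    exact hτ n
  have hroot : ∀ j : ℕ, p.IsRoot ((τ ^ j) x) := by
    intro j
    induction j with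
    | zero => exact hx
    | succ j ih =>
      rw [pow_succ', AlgEquiv.mul_apply]
      have := ih.map (f := (τ : Ω →+* Ω))
      rw [hmap] at this
      exact this
  -- Six iterates of `x` lie among at most five roots, so `x` is fixed by some `τ^m` with `1 ≤ m ≤
  -- 5`, and such an `m` divides 120.
  obtain ⟨i, hi, j, hj, hij, he⟩ := Finset.exists_ne_map_eq_of_card_lt_of_maps_to
    (s := Finset.range 6) (t := p.roots.toFinset) (f := fun j => (τ ^ j) x) (by
      refine lt_of_le_of_lt ((Multiset.toFinset_card_le _).trans ((card_roots' p).trans h5)) ?_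
      simp) (fun j _ => by
      rw [Finset.mem_coe, Multiset.mem_toFinset, mem_roots hp]
      exact hroot j)
  wlog hlt : i < j generalizing i j
  · exact this j hj i hi hij.symm he.symm (by omega)
  have hm : (τ ^ (j - i)) x = x := by
    apply (τ ^ i).injective
    rw [← AlgEquiv.mul_apply, ← pow_add, Nat.add_sub_cancel' hlt.le]
    exact he.symm
  have hdvd : j - i ∣ 120 := by
    have hj6 := Finset.mem_range.1 hj
    have h1 : 1 ≤ j - i := by omega
    have h2 : j - i ≤ 5 := by omega
    generalize j - i = m at h1 h2
    interval_cases m <;> decide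
  obtain ⟨q, hq⟩ := hdvd
  rw [hq, pow_mul]
  have : ∀ q : ℕ, ((τ ^ (j - i)) ^ q) x = x := by
    intro q
    induction q with
    | zero => rfl
    | succ q ih => rw [pow_succ, AlgEquiv.mul_apply, hm, ih]
  exact this q

/-- Induction on the tower: if `σ^(120^i)` fixes `K_i`, it fixes the coefficients of `p_i` and
permutes its roots, so its 120th power fixes `θ_i` too. No normality of the tower is needed. -/
theorem IsAuxiliarySystem.pow_apply_eq_self {r : ℕ} {p : ℕ → Polynomial Ω} {θ : ℕ → Ω}
    (h : IsAuxiliarySystem k K r p θ) (σ : Ω ≃ₐ[K] Ω) {i : ℕ} (hi : i ≤ r) :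
    ∀ x ∈ stageField K θ i, (σ ^ 120 ^ i) x = x := by
  have key : ∀ (τ : Ω ≃ₐ[K] Ω) (i : ℕ), (∀ j < i, τ (θ j) = θ j) →
      ∀ x ∈ stageField K θ i, τ x = x := by
    intro τ i hτ x hx
    have hle : stageField K θ i ≤ IntermediateField.fixedField (Subgroup.zpowers τ) := by
      rw [stageField, IntermediateField.adjoin_le_iff]
      rintro _ ⟨j, hj, rfl⟩
      have hz : Subgroup.zpowers τ ≤ MulAction.stabilizer (Ω ≃ₐ[K] Ω) (θ j) := by
        rw [Subgroup.zpowers_le]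
        exact hτ j hj
      exact IntermediateField.mem_fixedField_iff _ _ |>.2 fun g hg => hz hg
    exact (IntermediateField.mem_fixedField_iff _ _).1 (hle hx) τ (Subgroup.mem_zpowers τ)
  induction i with
  | zero => exact key _ 0 (by simp)
  | succ i ih =>
    replace ih := ih (by omega)
    refine key _ _ fun j hj => ?_
    rw [pow_succ, pow_mul]
    rcases Nat.lt_succ_iff_lt_or_eq.1 hj with hj | rfl
    · have h1 := ih (θ j) (mem_stageField θ hj)
      have : ∀ q : ℕ, ((σ ^ 120 ^ i) ^ q) (θ j) = θ j := by
        intro q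
        induction q with
        | zero => rfl
        | succ q ih => rw [pow_succ, AlgEquiv.mul_apply, h1, ih]
      exact this _
    · have ho := h.oneParameter j (by omega)
      exact pow_apply_eq_self_of_isRoot ho.1.ne_zero (h.degree_le j (by omega))
        (fun n => ih _ (ho.coeff_mem n)) (h.isRoot j (by omega))

end GaloisAction

/-! ### The Galois group of the general nonic induces all permutations of the roots -/

section GeneralPolynomial

variable (k : Type*) [Field k]

/-- Substitution of the elementary symmetric polynomials for the indeterminates. -/
noncomputable def esymmSubst : MvPolynomial (Fin 9) k →ₐ[k] MvPolynomial (Fin 9) k :=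
  (MvPolynomial.symmetricSubalgebra (Fin 9) k).val.comp (MvPolynomial.esymmAlgHom (Fin 9) k 9)

theorem esymmSubst_injective : Function.Injective (esymmSubst k) :=
  Subtype.val_injective.comp (MvPolynomial.esymmAlgHom_injective k (by simp))

theorem esymmSubst_X (i : Fin 9) :
    esymmSubst k (MvPolynomial.X i) = MvPolynomial.esymm (Fin 9) k (i + 1) := by
  simp [esymmSubst, MvPolynomial.esymmAlgHom]

theorem rename_esymmSubst (π : Equiv.Perm (Fin 9)) (q : MvPolynomial (Fin 9) k) :
    MvPolynomial.rename π (esymmSubst k q) = esymmSubst k q :=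
  (MvPolynomial.esymmAlgHom (Fin 9) k 9 q).2 π

variable (F : Type*) [Field F] [Algebra (MvPolynomial (Fin 9) k) F]
  [IsFractionRing (MvPolynomial (Fin 9) k) F]

theorem algebraMap_comp_esymmSubst_injective : Function.Injective
    ((algebraMap (MvPolynomial (Fin 9) k) F).comp (esymmSubst k).toRingHom) :=
  (IsFractionRing.injective _ F).comp (esymmSubst_injective k)

/-- The embedding of the field of coefficients into the field of roots. -/
noncomputable def coeffFieldEmbedding : CoeffField k →+* F :=
  IsFractionRing.lift (algebraMap_comp_esymmSubst_injective k F)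

theorem coeffFieldEmbedding_algebraMap (q : MvPolynomial (Fin 9) k) :
    coeffFieldEmbedding k F (algebraMap _ (CoeffField k) q) =
      algebraMap (MvPolynomial (Fin 9) k) F (esymmSubst k q) :=
  IsFractionRing.lift_algebraMap _ _

/-- The indeterminate `c_{i+1}` goes to the elementary symmetric polynomial of degree `i + 1`
without sign, so the roots are the negatives of the variables. -/
theorem map_generalNonic : (generalNonic k).map (coeffFieldEmbedding k F) =
    ∏ i : Fin 9, (X + C (algebraMap (MvPolynomial (Fin 9) k) F (MvPolynomial.X i))) := by
  have h := congrArg (Polynomial.map (algebraMap (MvPolynomial (Fin 9) k) F))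
    (MvPolynomial.prod_C_add_X_eq_sum_esymm k (Fin 9))
  rw [Finset.sum_range_succ', Finset.sum_range, Polynomial.map_prod] at h
  simp only [Polynomial.map_add, Polynomial.map_X, Polynomial.map_C] at h
  rw [h, generalNonic]
  simp only [Polynomial.map_add, Polynomial.map_pow, Polynomial.map_X, Polynomial.map_sum,
    Polynomial.map_mul, Polynomial.map_C, generalCoeff, coeffFieldEmbedding_algebraMap,
    esymmSubst_X, Fintype.card_fin, MvPolynomial.esymm_zero]
  rw [add_comm (X ^ 9 : F[X])]
  congr 1
  simp

theorem algebraIsAlgebraic_coeffFieldEmbedding [Algebra (CoeffField k) F]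
    (hF : algebraMap (CoeffField k) F = coeffFieldEmbedding k F) :
    Algebra.IsAlgebraic (CoeffField k) F := by
  have hX : ∀ i, IsAlgebraic (CoeffField k)
      (algebraMap (MvPolynomial (Fin 9) k) F (MvPolynomial.X i)) := by
    intro i
    have hmon : generalNonic k ≠ 0 := by
      intro h
      have := map_generalNonic k F
      rw [h, Polynomial.map_zero] at this
      exact (monic_prod_of_monic _ _ fun i _ => monic_X_add_C _).ne_zero this.symm
    have hroot : IsAlgebraic (CoeffField k)
        (-algebraMap (MvPolynomial (Fin 9) k) F (MvPolynomial.X i)) := by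
      refine ⟨generalNonic k, hmon, ?_⟩
      rw [aeval_def, ← eval_map, hF, map_generalNonic, eval_prod]
      exact Finset.prod_eq_zero (Finset.mem_univ i) (by simp)
    simpa using hroot.neg
  have hR : ∀ q, IsAlgebraic (CoeffField k) (algebraMap (MvPolynomial (Fin 9) k) F q) := by
    intro q
    induction q using MvPolynomial.induction_on with
    | C a =>
      have : algebraMap (MvPolynomial (Fin 9) k) F (MvPolynomial.C a) =
          algebraMap (CoeffField k) F (algebraMap (MvPolynomial (Fin 9) k) (CoeffField k)
            (MvPolynomial.C a)) := by
        rw [hF, coeffFieldEmbedding_algebraMap, ← MvPolynomial.algebraMap_eq, AlgHom.commutes]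
      rw [this]
      exact isAlgebraic_algebraMap _
    | add p q hp hq =>
      rw [map_add]
      exact hp.add hq
    | mul_X p i hp =>
      rw [map_mul]
      exact hp.mul (hX i)
  refine ⟨fun x => ?_⟩
  obtain ⟨a, b, -, rfl⟩ := IsFractionRing.div_surjective (MvPolynomial (Fin 9) k) x
  rw [div_eq_mul_inv]
  exact (hR a).mul (hR b).inv

variable (Ω : Type*) [Field Ω] [Algebra (CoeffField k) Ω]

variable {Ω} in
theorem aroots_generalNonic (e : F →+* Ω)
    (he : algebraMap (CoeffField k) Ω = e.comp (coeffFieldEmbedding k F)) :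
    (generalNonic k).aroots Ω = Finset.univ.val.map fun i : Fin 9 =>
      -e (algebraMap (MvPolynomial (Fin 9) k) F (MvPolynomial.X i)) := by
  have h : (generalNonic k).map (algebraMap (CoeffField k) Ω) = ∏ i : Fin 9,
      (X - C (-e (algebraMap (MvPolynomial (Fin 9) k) F (MvPolynomial.X i)))) := by
    rw [he, ← Polynomial.map_map, map_generalNonic, Polynomial.map_prod]
    simp only [Polynomial.map_add, Polynomial.map_X, Polynomial.map_C, map_neg, sub_neg_eq_add]
  rw [aroots, h, ← Polynomial.roots_multiset_prod_X_sub_C (Finset.univ.val.map _), Multiset.map_map]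
  rfl

/-- A permutation of the variables fixes the symmetric functions, hence is an automorphism of the
root field over the coefficient field, and it lifts to the normal extension `Ω`. The root field `F`
is an abstract fraction field: the concrete one coincides as a type with the coefficient field,
whose identity algebra structure would compete with the embedding by symmetric functions. -/
theorem exists_roots_and_permutations_of_rootField (F : Type*) [Field F]
    [Algebra (MvPolynomial (Fin 9) k) F] [IsFractionRing (MvPolynomial (Fin 9) k) F]
    [IsAlgClosed Ω] [Normal (CoeffField k) Ω] :
    ∃ y : Fin 9 → Ω, Function.Injective y ∧
      (generalNonic k).aroots Ω = Finset.univ.val.map y ∧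
      ∀ π : Equiv.Perm (Fin 9), ∃ σ : Ω ≃ₐ[CoeffField k] Ω, ∀ i, σ (y i) = y (π i) := by
  let _ : Algebra (CoeffField k) F := (coeffFieldEmbedding k F).toAlgebra
  have hF : algebraMap (CoeffField k) F = coeffFieldEmbedding k F := rfl
  have := algebraIsAlgebraic_coeffFieldEmbedding k F hF
  let j : F →ₐ[CoeffField k] Ω := IsAlgClosed.lift
  let _ : Algebra F Ω := j.toRingHom.toAlgebra
  have hj : algebraMap F Ω = j.toRingHom := rfl
  have : IsScalarTower (CoeffField k) F Ω :=
    IsScalarTower.of_algebraMap_eq fun x => (j.commutes x).symm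
  have hinj : Function.Injective fun i : Fin 9 =>
      algebraMap (MvPolynomial (Fin 9) k) F (MvPolynomial.X i) :=
    (IsFractionRing.injective (MvPolynomial (Fin 9) k) F).comp MvPolynomial.X_injective
  refine ⟨fun i => -algebraMap F Ω (algebraMap (MvPolynomial (Fin 9) k) F (MvPolynomial.X i)),
    fun a b hab => ?_, ?_, fun π => ?_⟩
  · exact hinj ((algebraMap F Ω).injective (neg_injective hab))
  · exact aroots_generalNonic k F (algebraMap F Ω) (RingHom.ext fun x => (j.commutes x).symm)
  · let χ : F ≃+* F := IsFractionRing.ringEquivOfRingEquiv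
      (MvPolynomial.renameEquiv k π).toRingEquiv
    have hχ : ∀ q, χ (algebraMap (MvPolynomial (Fin 9) k) F q) =
        algebraMap (MvPolynomial (Fin 9) k) F (MvPolynomial.rename π q) := fun q =>
      IsFractionRing.ringEquivOfRingEquiv_algebraMap _ q
    have hcomp : (χ : F →+* F).comp (coeffFieldEmbedding k F) = coeffFieldEmbedding k F := by
      refine IsFractionRing.injective_comp_algebraMap (A := MvPolynomial (Fin 9) k)
        (RingHom.ext fun q => ?_)
      simp only [RingHom.comp_apply, coeffFieldEmbedding_algebraMap]
      exact (hχ _).trans (by rw [rename_esymmSubst])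
    let χ' : F ≃ₐ[CoeffField k] F := AlgEquiv.ofRingEquiv (f := χ) fun x =>
      RingHom.congr_fun hcomp x
    refine ⟨χ'.liftNormal Ω, fun i => ?_⟩
    rw [map_neg, AlgEquiv.liftNormal_commutes]
    congr 2
    exact (hχ _).trans (by rw [MvPolynomial.rename_X])

theorem exists_roots_and_permutations [IsAlgClosed Ω] [Normal (CoeffField k) Ω] :
    ∃ y : Fin 9 → Ω, Function.Injective y ∧
      (generalNonic k).aroots Ω = Finset.univ.val.map y ∧
      ∀ π : Equiv.Perm (Fin 9), ∃ σ : Ω ≃ₐ[CoeffField k] Ω, ∀ i, σ (y i) = y (π i) :=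
  exists_roots_and_permutations_of_rootField k Ω (FractionRing (MvPolynomial (Fin 9) k))

end GeneralPolynomial

/-! ### Injectivity through 7-cycles, and the inverse substitution -/

section SevenCycles

/-- There is a cycle of length seven on nine letters which fixes `i` and maps `j` to `l`. -/
theorem exists_perm_pow_seven_eq_one {i j l : Fin 9} (hij : i ≠ j) (hil : i ≠ l) (hjl : j ≠ l) :
    ∃ π : Equiv.Perm (Fin 9), π ^ 7 = 1 ∧ π i = i ∧ π j = l := by
  -- By 3-transitivity, it suffices to conjugate the cycle `(1 2 3 4 5 6 7)`, which fixes 0 and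
  -- sends 1 to 2.
  have h3 := Equiv.Perm.isMultiplyPretransitive (Fin 9) 3
  obtain ⟨g, hg⟩ := h3.exists_smul_eq (⟨![0, 1, 2], by decide⟩ : Fin 3 ↪ Fin 9)
    (⟨![i, j, l], by
      intro a b hab
      fin_cases a <;> fin_cases b <;> simp_all⟩ : Fin 3 ↪ Fin 9)
  have h0 : g 0 = i := DFunLike.congr_fun hg 0
  have h1 : g 1 = j := DFunLike.congr_fun hg 1
  have h2 : g 2 = l := DFunLike.congr_fun hg 2
  let c : Equiv.Perm (Fin 9) := ⟨![0, 2, 3, 4, 5, 6, 7, 1, 8], ![0, 7, 1, 2, 3, 4, 5, 6, 8],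
    by decide, by decide⟩
  have hc : c ^ 7 = 1 := by decide
  refine ⟨g * c * g⁻¹, ?_, ?_, ?_⟩
  · rw [conj_pow, hc, mul_one, mul_inv_cancel]
  · rw [← h0]
    change g (c (g.symm (g 0))) = g 0
    rw [Equiv.symm_apply_apply]
    rfl
  · rw [← h1, ← h2]
    change g (c (g.symm (g 1))) = g 2
    rw [Equiv.symm_apply_apply]
    rfl

variable {k : Type*} {K Ω : Type*} [Field k] [Field K] [Field Ω] [Algebra k K] [Algebra k Ω]
  [Algebra K Ω] [IsScalarTower k K Ω]

/-- If the Galois group over `K` induces all permutations of `y₀, …, y₈`, then a polynomial function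
over the last field of a system of auxiliary equations is injective or constant on them. -/
theorem IsAuxiliarySystem.injective_or_constant {r : ℕ} {p : ℕ → Polynomial Ω} {θ : ℕ → Ω}
    (h : IsAuxiliarySystem k K r p θ) (y : Fin 9 → Ω)
    (hy : ∀ π : Equiv.Perm (Fin 9), ∃ σ : Ω ≃ₐ[K] Ω, ∀ i, σ (y i) = y (π i))
    (P : (stageField K θ r)[X]) :
    Function.Injective (fun i => aeval (y i) P) ∨ ∃ i, ∀ j, aeval (y j) P = aeval (y i) P := by
  by_contra! hcon
  obtain ⟨hinj, hconst⟩ := hcon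
  refine hinj fun i j hij => ?_
  by_contra hne
  obtain ⟨l, hl⟩ := hconst i
  have hil : i ≠ l := by
    rintro rfl
    exact hl rfl
  have hjl : j ≠ l := by
    rintro rfl
    exact hl hij.symm
  obtain ⟨π, hπ, hπi, hπj⟩ := exists_perm_pow_seven_eq_one hne hil hjl
  obtain ⟨σ, hσ⟩ := hy π
  have hpow : ∀ (m : ℕ) (a : Fin 9), (σ ^ m) (y a) = y ((π ^ m) a) := by
    intro m
    induction m with
    | zero => simp
    | succ m ih =>
      intro a
      rw [pow_succ, AlgEquiv.mul_apply, hσ, ih, pow_succ, Equiv.Perm.mul_apply]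
  -- Since `120 = 7 · 17 + 1`, the power that fixes the tower leaves a 7-cycle unchanged. Applied to
  -- `P(y_i) = P(y_j)`, it yields `P(y_i) = P(y_l)`, a contradiction.
  have hπr : π ^ 120 ^ r = π := by
    have h7 : 120 ^ r % 7 = 1 := by
      rw [Nat.pow_mod]
      simp
    rw [← Nat.div_add_mod (120 ^ r) 7, h7, pow_add, pow_mul, hπ, one_pow, one_mul, pow_one]
  have hfix := h.pow_apply_eq_self σ le_rfl
  have hP : ∀ a, (σ ^ 120 ^ r) (aeval (y a) P) = aeval (y (π a)) P := by
    intro a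
    rw [aeval_eq_sum_range, aeval_eq_sum_range, map_sum]
    refine Finset.sum_congr rfl fun n _ => ?_
    rw [Algebra.smul_def, Algebra.smul_def, map_mul, map_pow, hpow, hπr]
    congr 1
    exact hfix _ (P.coeff n).2
  have h1 := hP i
  have h2 := hP j
  rw [hπi] at h1
  rw [hπj] at h2
  exact hl (by rw [← h1, ← h2, show aeval (y i) P = aeval (y j) P from hij])

theorem coeff_coeffsToPoly {F : Type*} [Field F] {n : ℕ} (a : Fin n → F) (i : Fin n) :
    (coeffsToPoly F n a).coeff i = a i := by
  rw [coeffsToPoly_apply, finsetSum_coeff]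
  simp [coeff_X_pow, Fin.val_inj]

theorem degree_coeffsToPoly_lt {F : Type*} [Field F] {n : ℕ} (a : Fin n → F) :
    (coeffsToPoly F n a).degree < n := by
  rw [← mem_degreeLT, coeffsToPoly_apply]
  refine Submodule.sum_mem _ fun i _ => ?_
  rw [mem_degreeLT]
  exact (degree_C_mul_X_pow_le _ _).trans_lt (by exact_mod_cast i.2)

/-- A polynomial map which is injective on a finite Galois stable set is inverted on it by a
polynomial over the same field. -/
theorem exists_polynomial_inverse {F : Type*} [Field F] [Algebra F Ω] [IsGalois F Ω] {n : ℕ}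
    (y : Fin n → Ω) (hy : ∀ σ : Ω ≃ₐ[F] Ω, (Finset.univ.val.map y).map σ = Finset.univ.val.map y)
    (P : F[X]) (hP : Function.Injective fun i => aeval (y i) P) :
    ∃ S : F[X], ∀ i, aeval (aeval (y i) P) S = y i := by
  obtain ⟨S, hS⟩ : ∃ S, S = Lagrange.interpolate Finset.univ (fun i => aeval (y i) P) y := ⟨_, rfl⟩
  have hSe : ∀ i, S.eval (aeval (y i) P) = y i := fun i => by
    rw [hS]
    exact Lagrange.eval_interpolate_at_node y hP.injOn (Finset.mem_univ i)
  have hSd : S.degree < (Finset.univ : Finset (Fin n)).card := by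
    rw [hS]
    exact Lagrange.degree_interpolate_lt y hP.injOn
  -- Conjugating the interpolation polynomial permutes its nodes and values compatibly, so
  -- uniqueness of interpolation makes it Galois invariant.
  have hfix : ∀ σ : Ω ≃ₐ[F] Ω, S.map (σ : Ω →+* Ω) = S := by
    intro σ
    refine eq_of_degrees_lt_of_eval_index_eq Finset.univ hP.injOn
      (by rwa [degree_map]) hSd fun i _ => ?_
    obtain ⟨j, hj⟩ : ∃ j, σ (y j) = y i := by
      have h1 : y i ∈ (Finset.univ.val.map y).map σ := by
        rw [hy]
        exact Multiset.mem_map_of_mem y (Finset.mem_univ i)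
      simpa using h1
    have h2 : aeval (y i) P = σ (aeval (y j) P) := by
      rw [← hj]
      exact aeval_algHom_apply (σ : Ω →ₐ[F] Ω) (y j) P
    rw [hSe, h2, ← hj]
    conv_rhs => rw [← hSe j]
    exact eval_map_apply (σ : Ω →+* Ω) _
  have hc : ∀ m, ∃ c : F, algebraMap F Ω c = S.coeff m := fun m =>
    exists_algebraMap_eq_of_forall_fixed fun σ => by
      conv_rhs => rw [← hfix σ, coeff_map]
      rfl
  obtain ⟨S', hS'⟩ := (mem_lifts S).1 ((lifts_iff_coeff_lifts S).2 hc)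
  exact ⟨S', fun i => by rw [← eval_map_algebraMap, hS', hSe]⟩

end SevenCycles

/-! ### Assembly of the reduction -/

theorem exists_reduction_of_general_nonic (k : Type*) [Field k] [CharZero k] (Ω : Type*) [Field Ω]
    [Algebra k Ω] [Algebra (CoeffField k) Ω] [IsScalarTower k (CoeffField k) Ω] [IsAlgClosed Ω]
    [IsGalois (CoeffField k) Ω] :
    ∃ (r : ℕ) (p : ℕ → Polynomial Ω) (θ : ℕ → Ω),
      IsAuxiliarySystem k (CoeffField k) r p θ ∧
      ∃ a : Fin 9 → Ω,
        (∀ i, a i ∈ stageField (CoeffField k) θ r) ∧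
        (∃ C₅ ∈ stageField (CoeffField k) θ r, ∃ C₆ ∈ stageField (CoeffField k) θ r,
          ∃ C₇ ∈ stageField (CoeffField k) θ r, ∃ C₈ ∈ stageField (CoeffField k) θ r,
          ∃ C₉ ∈ stageField (CoeffField k) θ r,
          transformedPoly (generalNonic k) (tschirnhausPoly a) =
            X ^ 9 + C C₅ * X ^ 4 + C C₆ * X ^ 3 + C C₇ * X ^ 2 + C C₈ * X + C C₉) ∧
        ∃ S : Polynomial Ω,
          (∀ n, S.coeff n ∈ stageField (CoeffField k) θ r) ∧
          ∀ x ∈ (generalNonic k).aroots Ω, S.eval ((tschirnhausPoly a).eval x) = x := by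
  have hK : CharZero (CoeffField k) :=
    charZero_of_injective_algebraMap (algebraMap k (CoeffField k)).injective
  have hΩ : CharZero Ω := charZero_of_injective_algebraMap (algebraMap (CoeffField k) Ω).injective
  obtain ⟨E, a, ⟨r, p, θ, hs, -, rfl⟩, ha0, ha⟩ :=
    exists_tschirnhaus_power_sums_eq_zero k (Ω := Ω) (generalNonic k)
  obtain ⟨y, hyinj, hroots, hperm⟩ := exists_roots_and_permutations k Ω
  have hgal := map_aroots_eq_of_intermediateField (generalNonic k) (stageField (CoeffField k) θ r)
  have hcard : ((generalNonic k).aroots Ω).card = 9 := by simp [hroots]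
  obtain ⟨P, hPdef⟩ : ∃ P, P = coeffsToPoly (stageField (CoeffField k) θ r) 9 a := ⟨_, rfl⟩
  rw [← hPdef] at ha
  have hT : ∀ x, (tschirnhausPoly fun i => (a i : Ω)).eval x = aeval x P := by
    intro x
    rw [hPdef, coeffsToPoly_apply, tschirnhausPoly]
    simp only [eval_finsetSum, eval_mul, eval_C, eval_pow, eval_X, map_sum, map_mul, aeval_C,
      map_pow, aeval_X]
    rfl
  have hinj : Function.Injective fun i => aeval (y i) P := by
    refine (hs.injective_or_constant y hperm P).resolve_right ?_
    rintro ⟨i, hi⟩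
    -- The first power sum is nine times the constant value.
    have hsum : aeval (y i) P = 0 := by
      have h1 := algebraMap_sumFunctional _ hgal P
      have h2 := ha 1 le_rfl (by norm_num)
      rw [pow_one] at h2
      rw [h2, map_zero, hroots, Multiset.map_map] at h1
      simp only [Function.comp_def, hi] at h1
      simp only [Multiset.map_const', Multiset.sum_replicate, Finset.card_val, Finset.card_univ,
        Fintype.card_fin, nsmul_eq_mul] at h1
      exact (mul_eq_zero.1 h1.symm).resolve_left (by norm_num)
    -- A polynomial of degree at most eight with nine distinct zeros vanishes.
    have hP0 : P.map (algebraMap (stageField (CoeffField k) θ r) Ω) = 0 := by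
      refine eq_zero_of_degree_lt_of_eval_index_eq_zero (s := Finset.univ) (v := y) hyinj.injOn ?_
        fun j _ => ?_
      · rw [degree_map, hPdef]
        simpa using degree_coeffsToPoly_lt a
      · rw [eval_map_algebraMap, hi, hsum]
    rw [Polynomial.map_eq_zero] at hP0
    exact ha0 (funext fun j => by rw [← coeff_coeffsToPoly a j, ← hPdef, hP0]; rfl)
  obtain ⟨S, hS⟩ := exists_polynomial_inverse y (fun σ => by rw [← hroots]; exact hgal σ) P hinj
  refine ⟨r, p, θ, hs, fun i => a i, fun i => (a i).2, ?_,
    S.map (algebraMap _ Ω), fun n => ?_, fun x hx => ?_⟩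
  · have hQ : transformedPoly (generalNonic k) (tschirnhausPoly fun i => (a i : Ω)) =
        (((generalNonic k).aroots Ω).map fun x => X - C (aeval x P)).prod := by
      simp only [transformedPoly, hT]
    rw [hQ]
    have hz := coeff_prod_X_sub_C_aeval_eq_zero _ hgal P 4 ha
    have hmem := exists_algebraMap_eq_coeff_prod hgal P
    have hQm : ((((generalNonic k).aroots Ω).map fun x => X - C (aeval x P)).prod).Monic :=
      monic_multiset_prod_of_monic _ _ fun x _ => monic_X_sub_C _
    have hQd : ((((generalNonic k).aroots Ω).map fun x => X - C (aeval x P)).prod).natDegree =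
        9 := by
      refine Eq.trans ?_ hcard
      rw [← Multiset.card_map (fun x => aeval x P), ← natDegree_multiset_prod_X_sub_C_eq_card,
        Multiset.map_map]
      rfl
    rw [hcard] at hz
    generalize (((generalNonic k).aroots Ω).map fun x => X - C (aeval x P)).prod = Q at *
    have hmem' : ∀ n, Q.coeff n ∈ stageField (CoeffField k) θ r := fun n => by
      obtain ⟨c, hc⟩ := hmem n
      rw [← hc]
      exact c.2
    refine ⟨Q.coeff 4, hmem' 4, Q.coeff 3, hmem' 3, Q.coeff 2, hmem' 2, Q.coeff 1, hmem' 1,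
      Q.coeff 0, hmem' 0, ?_⟩
    have h9 : Q.coeff 9 = 1 := by
      rw [← hQd]
      exact hQm
    conv_lhs => rw [Q.as_sum_range_C_mul_X_pow, hQd]
    simp only [Finset.sum_range_succ, Finset.sum_range_zero, h9, hz 5 (by norm_num) (by norm_num),
      hz 6 (by norm_num) (by norm_num), hz 7 (by norm_num) (by norm_num),
      hz 8 (by norm_num) (by norm_num), C_0, C_1]
    ring
  · rw [coeff_map]
    exact (S.coeff n).2
  · rw [hroots] at hx
    obtain ⟨i, -, rfl⟩ := Multiset.mem_map.1 hx
    rw [hT, eval_map_algebraMap, hS]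

theorem mainTheorem2 (k : Type*) [Field k] [CharZero k] :
    ∃ (r : ℕ) (p : ℕ → (AlgebraicClosure (CoeffField k))[X])
      (θ : ℕ → AlgebraicClosure (CoeffField k)),
      IsAuxiliarySystem k (CoeffField k) r p θ ∧
      ∃ a : Fin 9 → AlgebraicClosure (CoeffField k),
        (∀ i, a i ∈ stageField (CoeffField k) θ r) ∧
        (∃ C₅ ∈ stageField (CoeffField k) θ r, ∃ C₆ ∈ stageField (CoeffField k) θ r,
          ∃ C₇ ∈ stageField (CoeffField k) θ r, ∃ C₈ ∈ stageField (CoeffField k) θ r,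
          ∃ C₉ ∈ stageField (CoeffField k) θ r,
          transformedPoly (generalNonic k) (tschirnhausPoly a) =
            X ^ 9 + C C₅ * X ^ 4 + C C₆ * X ^ 3 + C C₇ * X ^ 2 + C C₈ * X + C C₉) ∧
        ∃ S : (AlgebraicClosure (CoeffField k))[X],
          (∀ n, S.coeff n ∈ stageField (CoeffField k) θ r) ∧
          ∀ x ∈ (generalNonic k).aroots (AlgebraicClosure (CoeffField k)),
            S.eval ((tschirnhausPoly a).eval x) = x := by
  have : CharZero (CoeffField k) :=
    charZero_of_injective_algebraMap (algebraMap k (CoeffField k)).injective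
  exact exists_reduction_of_general_nonic k (AlgebraicClosure (CoeffField k))
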